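/- **Setting.** A layered episodic MDP has a finite state space $\mathcal X$ partitioned into layers $\mathcal X_0,\dots,\mathcal X_L$ with $\mathcal X_0=\{x_0\}$ and $\mathcal X_L=\{x_L\}$, a finite non-empty action set $\mathcal A$, a transition function $P(x'\mid x,a)$ such that $P(\cdot\mid x,a)$ is a probability distribution on $\mathcal X_{h+1}$ for $x\in\mathcal X_h$, $h<L$, and for each pair $(x,a)$ a reward distribution on $[0,1]$ with mean $r(x,a)$. Write $X=|\mathcal X|$, $A=|\mathcal A|$, $X_h=|\mathcal X_h|$ (with $X_{L+1}=0$), and let $h(x)$ be the layer index of $x$. In episode $t=1,\dots,T$ the learner, who knows only $\mathcal X$ with its layers, $\mathcal A$, $T$ and $\delta\in(0,1)$, executes a stochastic policy $\pi_t$ chosen from the past: given the past, the trajectory $x_0,a_0,x_1,\dots,a_{L-1},x_L$ follows $\pi_t$ and $P$, and given the trajectory the realized rewards are independent draws from the reward distributions of the visited pairs $(x_h,a_h)$; the learner observes the trajectory and these rewards. For a policy $\pi$ let $V(\pi)=\mathbb E\big[\sum_{h=0}^{L-1} r(x_h,a_h)\mid P,\pi\big]$, let $\pi^*$ be a policy that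 maximizes $V$, and let $\mathrm{Reg}_T=T\,V(\pi^*)-\sum_{t=1}^T V(\pi_t)$. The occupancy measure of a transition function $P'$ and a policy $\pi$ is $q^{P',\pi}(x,a,x')=\mathbb P\{x_{h(x)}=x,\ a_{h(x)}=a,\ x_{h(x)+1}=x'\mid P',\pi\}$. A policy $\pi$ is induced by $q$ if $\pi(a\mid x)=\sum_{x'}q(x,a,x')\big/\sum_{b,x'}q(x,b,x')$ whenever the denominator is non-zero ($\pi(\cdot\mid x)$ is an arbitrary distribution otherwise). **UCRL-LP.** The episodes are grouped into epochs $i=1,2,\dots$; in epoch $i$ a policy $\pi_i$ induced by an occupancy measure $\hat q_i$ is executed in all episodes. In the first epoch, $\hat q_1(x,a,x')=1/(X_{h}AX_{h+1})$ for $x\in\mathcal X_h$, $x'\in\mathcal X_{h+1}$ (and $0$ otherwise). Let $N_i(x,a)$, $N_i(x,a,x')$ be the numbers of visits to $(x,a)$ and $(x,a,x')$ before epoch $i$, and $n_i(x,a)$ the number of visits to $(x,a)$ so far in epoch $i$. Epoch $i$ ends after the first episode at which $n_i(x,a)\ge\max\{m,N_i(x,a)\}$ for some $(x,a)\in\mathcal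 X\times\mathcal A$, where $m\in\{0,1\}$ is fixed (for $m=1$ this is doubling of a number of visits, pairs never visited being disregarded; for $m=0$ it is the bare test $n_i\ge N_i$). At the start of every epoch $i\ge2$, set $$\bar P_i(x'|x,a)=\frac{N_i(x,a,x')}{\max\{1,N_i(x,a)\}},\qquad \epsilon_i(x,a)=\sqrt{\frac{2X_{h(x)+1}\log(TXA/\delta)}{\max\{1,N_i(x,a)\}}},$$ let $\mathcal P_i$ be the set of layered transition functions $P'$ with $\|P'(\cdot|x,a)-\bar P_i(\cdot|x,a)\|_1\le\epsilon_i(x,a)$ for all $(x,a)$, let $\bar r_i(x,a)$ be the sum of the rewards realized at $(x,a)$ before epoch $i$ divided by $\max\{1,N_i(x,a)\}$, set $$\hat r_i(x,a)=\min\Big\{1,\ \bar r_i(x,a)+\sqrt{\tfrac{2\log(TXA/\delta)}{\max\{1,N_i(x,a)\}}}\Big\},$$ and let $\hat q_i$ be any maximizer of the linear functional $\sum_{x,a,x'}q(x,a,x')\,\hat r_i(x,a)$ over the set of occupancy measures $\{q^{P',\pi}: P'\in\mathcal P_i,\ \pi\text{ a policy}\}$. **Theorem.** There is a universal constant $C>0$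 such that for every layered episodic MDP, every $T$ and every $\delta\in(0,1)$, and for either value of $m$, with probability at least $1-5\delta$ the UCRL-LP algorithm satisfies $$\mathrm{Reg}_T\le C\,L\,X\sqrt{T A\log\Big(\frac{TXA}{\delta}\Big)}.$$ -/

import Mathlib

open MeasureTheory ProbabilityTheory

universe u v w

noncomputable section

namespace UCRLLP

/-- A finite state space partitioned into layers `0, …, L`, the layers `0` and `L` being
singletons. -/
structure LayeredSpace (S : Type u) (L : ℕ) where
  /-- the index `h(x)` of the layer of the state `x` -/
  layer : S → ℕ
  layer_le : ∀ x, layer x ≤ L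
  /-- the initial state -/
  start : S
  /-- the final state -/
  goal : S
  layer_eq_zero_iff : ∀ x, layer x = 0 ↔ x = start
  layer_eq_last_iff : ∀ x, layer x = L ↔ x = goal

variable {S : Type u} {A : Type v} {L : ℕ}

/-- Number of states in layer `h`. -/
def LayeredSpace.layerCard [Fintype S] (G : LayeredSpace S L) (h : ℕ) : ℕ :=
  (Finset.univ.filter fun x => G.layer x = h).card

/-- `P x a x'` is the probability `P(x' | x, a)` of a layered transition function: transitions
only go from a layer to the next one (so nothing leaves the last layer, where no action is
taken). -/
structure IsTransition [Fintype S] (G : LayeredSpace S L) (P : S → A → S → ℝ) : Prop where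
  nonneg : ∀ x a x', 0 ≤ P x a x'
  layered : ∀ x a x', G.layer x' ≠ G.layer x + 1 → P x a x' = 0
  sum_eq_one : ∀ x a, G.layer x < L → ∑ x', P x a x' = 1

/-- `π x a` is the probability `π(a | x)` of a stochastic policy. -/
def IsPolicy [Fintype A] (π : S → A → ℝ) : Prop :=
  ∀ x, π x ∈ stdSimplex ℝ A

/-- A layered episodic MDP with stochastic rewards in `[0,1]`. -/
structure LayeredMDP (S : Type u) (A : Type v) (L : ℕ) [Fintype S] extends
    LayeredSpace S L where
  P : S → A → S → ℝ
  isTransition : IsTransition toLayeredSpace P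
  /-- the distribution of the realized reward for a state-action pair -/
  rewardLaw : S → A → Measure ℝ
  isProbabilityMeasure_rewardLaw : ∀ x a, IsProbabilityMeasure (rewardLaw x a)
  rewardLaw_unitInterval : ∀ x a, ∀ᵐ y ∂(rewardLaw x a), y ∈ Set.Icc (0 : ℝ) 1

/-- The expected reward function `r(x, a)`. -/
def LayeredMDP.r [Fintype S] (M : LayeredMDP S A L) (x : S) (a : A) : ℝ :=
  ∫ y, y ∂(M.rewardLaw x a)

/-- The state-action trajectory `x_0, …, x_L`, `a_0, …, a_{L-1}` of an episode. -/
abbrev Traj (S : Type u) (A : Type v) (L : ℕ) : Type (max u v) :=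
  (Fin (L + 1) → S) × (Fin L → A)

/-- The probability of a trajectory under transition function `P` and policy `π`. -/
def trajProb [DecidableEq S] (G : LayeredSpace S L) (P : S → A → S → ℝ) (π : S → A → ℝ)
    (σ : Traj S A L) : ℝ :=
  (if σ.1 0 = G.start then 1 else 0) *
    ∏ h : Fin L, π (σ.1 h.castSucc) (σ.2 h) * P (σ.1 h.castSucc) (σ.2 h) (σ.1 h.succ)

/-- The expected reward `V(π) = 𝔼[∑_{h<L} r(x_h, a_h) | P, π]` over an episode. -/
def LayeredMDP.V [Fintype S] [DecidableEq S] [Fintype A] (M : LayeredMDP S A L)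
    (π : S → A → ℝ) : ℝ :=
  ∑ σ : Traj S A L, trajProb M.toLayeredSpace M.P π σ *
    ∑ h : Fin L, M.r (σ.1 h.castSucc) (σ.2 h)

/-- `π` is an optimal policy. -/
def LayeredMDP.IsOptimal [Fintype S] [DecidableEq S] [Fintype A] (M : LayeredMDP S A L)
    (π : S → A → ℝ) : Prop :=
  IsPolicy π ∧ ∀ π' : S → A → ℝ, IsPolicy π' → M.V π' ≤ M.V π

/-- The regret over `T` episodes of the policies `π 0, …, π (T-1)` against `πs`. -/
def LayeredMDP.regret [Fintype S] [DecidableEq S] [Fintype A] (M : LayeredMDP S A L) (T : ℕ)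
    (πs : S → A → ℝ) (π : ℕ → S → A → ℝ) : ℝ :=
  T * M.V πs - ∑ t ∈ Finset.range T, M.V (π t)

/-- The occupancy measure induced by `P` and `π`: the probability that
`x_{h(x)} = x`, `a_{h(x)} = a` and `x_{h(x)+1} = x'` (zero for `x` in the last layer). -/
def occ [Fintype S] [DecidableEq S] [Fintype A] [DecidableEq A] (G : LayeredSpace S L)
    (P : S → A → S → ℝ) (π : S → A → ℝ) (x : S) (a : A) (x' : S) : ℝ :=
  ∑ σ : Traj S A L, trajProb G P π σ * ∑ h : Fin L,
    if (h : ℕ) = G.layer x ∧ σ.1 h.castSucc = x ∧ σ.2 h = a ∧ σ.1 h.succ = x' then 1 else 0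

/-- All occupancy measures induced by some policy and some transition function in `Ps`. -/
def occSet [Fintype S] [DecidableEq S] [Fintype A] [DecidableEq A] (G : LayeredSpace S L)
    (Ps : Set (S → A → S → ℝ)) : Set (S → A → S → ℝ) :=
  {q | ∃ P ∈ Ps, ∃ π : S → A → ℝ, IsPolicy π ∧ q = occ G P π}

/-- `π` is a policy induced by `q`: it is the conditional distribution of the action given the
state, and an arbitrary distribution at states to which `q` gives no mass. -/
def Induces [Fintype S] [Fintype A] (q : S → A → S → ℝ) (π : S → A → ℝ) : Prop :=
  IsPolicy π ∧ ∀ x, ∑ b, ∑ x', q x b x' ≠ 0 →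
    ∀ a, π x a = (∑ x', q x a x') / ∑ b, ∑ x', q x b x'

/-- The occupancy measure used in the first epoch. -/
def initOcc [Fintype S] [Fintype A] (G : LayeredSpace S L) (x : S) (_a : A) (x' : S) : ℝ :=
  if G.layer x' = G.layer x + 1 then
    1 / (G.layerCard (G.layer x) * Fintype.card A * G.layerCard (G.layer x + 1))
  else 0

section Algorithm

/-! Episodes are numbered from `0`. In this section `τ s` and `ρ s` are the trajectory and the
realized rewards observed in episode `s`. -/

variable [DecidableEq S] [DecidableEq A]

/-- Number of visits to `(x, a)` in the episodes before `t`. -/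
def numVisits (τ : ℕ → Traj S A L) (t : ℕ) (x : S) (a : A) : ℕ :=
  ∑ s ∈ Finset.range t, ∑ h : Fin L,
    if (τ s).1 h.castSucc = x ∧ (τ s).2 h = a then 1 else 0

/-- Number of visits to `(x, a, x')` in the episodes before `t`. -/
def numTransitions (τ : ℕ → Traj S A L) (t : ℕ) (x : S) (a : A) (x' : S) : ℕ :=
  ∑ s ∈ Finset.range t, ∑ h : Fin L,
    if (τ s).1 h.castSucc = x ∧ (τ s).2 h = a ∧ (τ s).1 h.succ = x' then 1 else 0

/-- Sum of the rewards realized at `(x, a)` in the episodes before `t`. -/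
def sumRewards (τ : ℕ → Traj S A L) (ρ : ℕ → Fin L → ℝ) (t : ℕ) (x : S) (a : A) : ℝ :=
  ∑ s ∈ Finset.range t, ∑ h : Fin L,
    if (τ s).1 h.castSucc = x ∧ (τ s).2 h = a then ρ s h else 0

open Classical in
/-- The first episode of the epoch to which episode `t` belongs. Write `N` for the number of
visits to a pair before the epoch and `n` for the number of visits since then. A new epoch starts
after an episode if `n ≥ max m N` for some pair. For `m = 0` this is the bare test `n ≥ N`, which
a pair never visited passes; for `m = 1` only visited pairs count, and an epoch ends exactly when
some number of visits has doubled (or become positive). -/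
def epochStart (m : ℕ) (τ : ℕ → Traj S A L) : ℕ → ℕ
  | 0 => 0
  | t + 1 =>
    if ∃ x a, max m (numVisits τ (epochStart m τ t) x a) ≤
        numVisits τ (t + 1) x a - numVisits τ (epochStart m τ t) x a
    then t + 1 else epochStart m τ t

/-- Empirical transition function at the beginning of an epoch starting with episode `t`. -/
def empP (τ : ℕ → Traj S A L) (t : ℕ) (x : S) (a : A) (x' : S) : ℝ :=
  (numTransitions τ t x a x' : ℝ) / max 1 (numVisits τ t x a : ℝ)

/-- Empirical reward function at the beginning of an epoch starting with episode `t`. -/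
def empR (τ : ℕ → Traj S A L) (ρ : ℕ → Fin L → ℝ) (t : ℕ) (x : S) (a : A) : ℝ :=
  sumRewards τ ρ t x a / max 1 (numVisits τ t x a : ℝ)

variable [Fintype S] [Fintype A]

/-- `log (T X A / δ)`. -/
def logTerm (S : Type u) (A : Type v) [Fintype S] [Fintype A] (T : ℕ) (δ : ℝ) : ℝ :=
  Real.log (T * Fintype.card S * Fintype.card A / δ)

/-- Confidence radius of the transition function. -/
def radP (G : LayeredSpace S L) (T : ℕ) (δ : ℝ) (τ : ℕ → Traj S A L) (t : ℕ) (x : S) (a : A) :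
    ℝ :=
  √(2 * G.layerCard (G.layer x + 1) * logTerm S A T δ / max 1 (numVisits τ t x a : ℝ))

/-- The confidence set of transition functions. -/
def confSet (G : LayeredSpace S L) (T : ℕ) (δ : ℝ) (τ : ℕ → Traj S A L) (t : ℕ) :
    Set (S → A → S → ℝ) :=
  {P | IsTransition G P ∧ ∀ x a, ∑ x', |P x a x' - empP τ t x a x'| ≤ radP G T δ τ t x a}

/-- Confidence radius of the reward function. -/
def radR (T : ℕ) (δ : ℝ) (τ : ℕ → Traj S A L) (t : ℕ) (x : S) (a : A) : ℝ :=
  √(2 * logTerm S A T δ / max 1 (numVisits τ t x a : ℝ))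

/-- Upper confidence bound for the reward function. -/
def ucbR (T : ℕ) (δ : ℝ) (τ : ℕ → Traj S A L) (ρ : ℕ → Fin L → ℝ) (t : ℕ) (x : S) (a : A) :
    ℝ :=
  min 1 (empR τ ρ t x a + radR T δ τ t x a)

/-- `q` maximizes `⟨q, ucbR⟩` over the occupancy measures of the transition functions in the
confidence set, at the beginning of an epoch starting with episode `t`. -/
def IsLPSolution (G : LayeredSpace S L) (T : ℕ) (δ : ℝ) (τ : ℕ → Traj S A L)
    (ρ : ℕ → Fin L → ℝ) (t : ℕ) (q : S → A → S → ℝ) : Prop :=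
  q ∈ occSet G (confSet G T δ τ t) ∧
    IsMaxOn (fun q' => ∑ x, ∑ a, ∑ x', q' x a x' * ucbR T δ τ ρ t x a)
      (occSet G (confSet G T δ τ t)) q

/-- The random variables `τ t`, `ρ t` (trajectory and rewards of episode `t`), `q t` and `π t`
(occupancy measure and policy used in episode `t`), for `t < T`, form a run of the UCRL-LP
algorithm on the MDP `M`. Here `ℱ t` is the information available before episode `t`. Any choice
among the solutions of an optimization problem and among the policies induced by a solution is
allowed. -/
structure IsRun (M : LayeredMDP S A L) (T : ℕ) (δ : ℝ) (m : ℕ)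
    {Ω : Type w} [mΩ : MeasurableSpace Ω] (μ : Measure Ω) (ℱ : Filtration ℕ mΩ)
    (τ : ℕ → Ω → Traj S A L) (ρ : ℕ → Ω → Fin L → ℝ)
    (q : ℕ → Ω → S → A → S → ℝ) (π : ℕ → Ω → S → A → ℝ) : Prop where
  measurable_traj : ∀ t < T, ∀ σ, MeasurableSet[ℱ (t + 1)] {ω | τ t ω = σ}
  measurable_rewards : ∀ t < T, Measurable[ℱ (t + 1)] (ρ t)
  measurable_occ : ∀ t < T, Measurable[ℱ t] (q t)
  measurable_policy : ∀ t < T, Measurable[ℱ t] (π t)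
  /-- Given the past, the trajectory of episode `t` follows `M.P` and `π t`, and given the
  trajectory the rewards are independent draws from the reward distributions. -/
  law : ∀ t < T, ∀ (σ : Traj S A L) (B : Set (Fin L → ℝ)), MeasurableSet B →
    μ⟦{ω | τ t ω = σ ∧ ρ t ω ∈ B} | ℱ t⟧ =ᵐ[μ] fun ω =>
      trajProb M.toLayeredSpace M.P (π t ω) σ *
        (Measure.pi fun h : Fin L => M.rewardLaw (σ.1 h.castSucc) (σ.2 h)).real B
  init : 0 < T → ∀ᵐ ω ∂μ, q 0 ω = initOcc M.toLayeredSpace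
  new_epoch : ∀ t, t + 1 < T → ∀ᵐ ω ∂μ,
    epochStart m (fun s => τ s ω) (t + 1) = t + 1 →
      IsLPSolution M.toLayeredSpace T δ (fun s => τ s ω) (fun s => ρ s ω) (t + 1) (q (t + 1) ω)
  same_epoch : ∀ t, t + 1 < T → ∀ᵐ ω ∂μ,
    epochStart m (fun s => τ s ω) (t + 1) ≠ t + 1 →
      q (t + 1) ω = q t ω ∧ π (t + 1) ω = π t ω
  induces : ∀ t < T, ∀ᵐ ω ∂μ, Induces (q t ω) (π t ω)

end Algorithm

end UCRLLP

end

/-! The proof is optimism plus a pigeonhole argument. Write $\iota=\log(TXA/\delta)$. Suppose that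
at every episode the true transition function lies in the confidence set and every empirical reward
is within its radius. Then the LP value dominates $V(\pi^*)$. The LP solution is the occupancy
measure of some $P'$ and $\pi'$, and the executed policy $\pi$ earns under $P'$ exactly what $\pi'$
earns. So the gap of an episode is at most the value of $\pi$ in the optimistic model minus its
value in the true one. Replacing $P'$ by $P$ shifts each layer's state distribution by at most the
expected sum of the one-step $\ell_1$ errors along $\pi$ under $P$. With $L$ layers of rewards in
$[0,1]$ the gap is at most $4L\,W_t$, where $W_t$ is the expected sum of the clipped widths
$\min(1,\epsilon)$ along an episode (`payoff_sub_le_of_optimistic`).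

The sum of the $W_t$ differs from the sum of the realized widths by a martingale, which costs
$2L\sqrt{T\iota}$ (`IsRun.measure_width_deviation_le`). Visit counts at most double within an epoch,
so a visit to $(x,a)$ costs about $\sqrt{X_{h+1}\iota/N}$. Summing over visits gives
$\sum_{x,a}\sqrt{X_{h+1}N_T(x,a)}$, and since $\sum X_{h+1}N_T\le TX$ this is at most $X\sqrt{TA}$
(`sum_width_le`). The first epoch lasts one episode and costs at most $L$. As $L\le X$, everything
fits into $33\,LX\sqrt{TA\iota}$ (`regret_le_of_good`).

All concentration comes from exponential supermartingales (`measure_sum_ge_le_of_supermartingale`).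
The number of visits is random, so the sum over visits is stopped at a fixed count $n$ with the
exponential parameter tuned to $n$ (`IsRun.measure_deviation_le`), and a union bound runs over $x$,
$a$ and $n<T$. The $\ell_1$ bound for transitions is a further union over subsets of the next layer,
which encode the signs of the errors. Four bad events of probability at most $\delta$ each are
excluded: transitions, rewards from either side, and widths. -/

noncomputable section

namespace UCRLLP

variable {S : Type u} {A : Type v} {L : ℕ}

/-! ### Trajectories of arbitrary length and their marginals -/

/-- Extension of a trajectory by one step. -/
def Traj.snoc {n : ℕ} (σ : Traj S A n) (a : A) (x : S) : Traj S A (n + 1) :=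
  (Fin.snoc (α := fun _ => S) σ.1 x, Fin.snoc (α := fun _ => A) σ.2 a)

@[simp] lemma Traj.snoc_fst_castSucc {n : ℕ} (σ : Traj S A n) (a : A) (x : S) (i : Fin (n + 1)) :
    (σ.snoc a x).1 i.castSucc = σ.1 i := by
  simp [Traj.snoc]

@[simp] lemma Traj.snoc_fst_last {n : ℕ} (σ : Traj S A n) (a : A) (x : S) :
    (σ.snoc a x).1 (Fin.last (n + 1)) = x := by
  simp [Traj.snoc]

@[simp] lemma Traj.snoc_snd_castSucc {n : ℕ} (σ : Traj S A n) (a : A) (x : S) (i : Fin n) :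
    (σ.snoc a x).2 i.castSucc = σ.2 i := by
  simp [Traj.snoc]

@[simp] lemma Traj.snoc_snd_last {n : ℕ} (σ : Traj S A n) (a : A) (x : S) :
    (σ.snoc a x).2 (Fin.last n) = a := by
  simp [Traj.snoc]

/-- A trajectory of length `n + 1` is a trajectory of length `n` with one more step. -/
def Traj.snocEquiv (S : Type u) (A : Type v) (n : ℕ) :
    Traj S A n × A × S ≃ Traj S A (n + 1) where
  toFun p := p.1.snoc p.2.1 p.2.2
  invFun σ := ((fun i => σ.1 i.castSucc, fun i => σ.2 i.castSucc), σ.2 (Fin.last n),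
    σ.1 (Fin.last (n + 1)))
  left_inv p := by ext <;> simp
  right_inv σ := by
    refine Prod.ext (funext fun i => ?_) (funext fun i => ?_)
    · refine Fin.lastCases ?_ (fun j => ?_) i <;> simp
    · refine Fin.lastCases ?_ (fun j => ?_) i <;> simp

lemma sum_traj_succ [Fintype S] [Fintype A] (n : ℕ) (f : Traj S A (n + 1) → ℝ) :
    ∑ σ, f σ = ∑ σ : Traj S A n, ∑ a, ∑ x, f (σ.snoc a x) := by
  classical
  rw [← (Traj.snocEquiv S A n).sum_comp, Fintype.sum_prod_type]
  refine Finset.sum_congr rfl fun σ _ => ?_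
  rw [Fintype.sum_prod_type]
  rfl

/-- The probability of a trajectory of arbitrary length started at `s₀`. -/
def pathProb [DecidableEq S] (s₀ : S) (P : S → A → S → ℝ) (π : S → A → ℝ) {n : ℕ}
    (σ : Traj S A n) : ℝ :=
  (if σ.1 0 = s₀ then 1 else 0) *
    ∏ h : Fin n, π (σ.1 h.castSucc) (σ.2 h) * P (σ.1 h.castSucc) (σ.2 h) (σ.1 h.succ)

lemma pathProb_snoc [DecidableEq S] (s₀ : S) (P : S → A → S → ℝ) (π : S → A → ℝ) {n : ℕ}
    (σ : Traj S A n) (a : A) (x : S) :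
    pathProb s₀ P π (σ.snoc a x) = pathProb s₀ P π σ *
      (π (σ.1 (Fin.last n)) a * P (σ.1 (Fin.last n)) a x) := by
  unfold pathProb
  rw [Fin.prod_univ_castSucc, ← mul_assoc]
  have h0 : (σ.snoc a x).1 0 = σ.1 0 := σ.snoc_fst_castSucc a x 0
  simp only [h0, Traj.snoc_fst_castSucc, Traj.snoc_snd_castSucc, Traj.snoc_snd_last,
    Fin.succ_last, Traj.snoc_fst_last, Fin.succ_castSucc]

lemma pathProb_nonneg [Fintype S] [DecidableEq S] [Fintype A] {G : LayeredSpace S L}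
    {P : S → A → S → ℝ} (hP : IsTransition G P) {π : S → A → ℝ} (hπ : IsPolicy π) {n : ℕ}
    (s₀ : S) (σ : Traj S A n) : 0 ≤ pathProb s₀ P π σ := by
  unfold pathProb
  refine mul_nonneg (by split_ifs <;> norm_num) (Finset.prod_nonneg fun h _ => ?_)
  exact mul_nonneg ((hπ _).1 _) (hP.nonneg _ _ _)

/-- Every factor of the product is nonzero, so the path starts at `G.start` and each transition
advances by one layer. -/
lemma layer_of_pathProb_ne_zero [Fintype S] [DecidableEq S] {G : LayeredSpace S L}
    {P : S → A → S → ℝ} (hP : IsTransition G P) {π : S → A → ℝ} {n : ℕ} {σ : Traj S A n}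
    (h : pathProb G.start P π σ ≠ 0) (i : Fin (n + 1)) : G.layer (σ.1 i) = i := by
  have h0 : σ.1 0 = G.start := by
    by_contra h0
    exact h (by simp [pathProb, h0])
  have h1 := right_ne_zero_of_mul h
  rw [Finset.prod_ne_zero_iff] at h1
  refine Fin.induction ?_ (fun j hj => ?_) i
  · simp [h0, (G.layer_eq_zero_iff _).2]
  · have h2 := right_ne_zero_of_mul (h1 j (Finset.mem_univ _))
    by_contra h3
    refine h2 (hP.layered _ _ _ ?_)
    rw [hj]
    simpa using h3

/-! ### State distributions under a policy -/

section Marginal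

variable [Fintype S] [DecidableEq S] [Fintype A]

/-- The distribution of the state after `n` steps. -/
def marg (s₀ : S) (P : S → A → S → ℝ) (π : S → A → ℝ) : ℕ → S → ℝ
  | 0, x => if x = s₀ then 1 else 0
  | n + 1, x' => ∑ x, ∑ a, marg s₀ P π n x * π x a * P x a x'

lemma sum_pathProb_mul_last (s₀ : S) (P : S → A → S → ℝ) (π : S → A → ℝ) (n : ℕ) (f : S → ℝ) :
    ∑ σ : Traj S A n, pathProb s₀ P π σ * f (σ.1 (Fin.last n)) = ∑ x, marg s₀ P π n x * f x := by
  induction n generalizing f with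
  | zero =>
    rw [Fintype.sum_prod_type]
    simp only [pathProb, Finset.univ_eq_empty, Finset.prod_empty, mul_one, marg]
    rw [← (Equiv.funUnique (Fin 1) S).symm.sum_comp]
    simp
  | succ n ih =>
    rw [sum_traj_succ]
    simp only [pathProb_snoc, Traj.snoc_fst_last]
    have h := ih (fun y => ∑ a, ∑ x, π y a * P y a x * f x)
    simp only [Finset.mul_sum] at h
    simp only [mul_assoc] at h ⊢
    rw [h]
    simp only [marg, Finset.sum_mul, mul_assoc]
    conv_rhs => rw [Finset.sum_comm]
    exact Finset.sum_congr rfl fun x _ => Finset.sum_comm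

variable {G : LayeredSpace S L} {P : S → A → S → ℝ} {π : S → A → ℝ}

omit [DecidableEq S] in
lemma sum_policy_mul_transition (hP : IsTransition G P) (hπ : IsPolicy π) {x : S}
    (hx : G.layer x < L) : ∑ a, ∑ x', π x a * P x a x' = 1 := by
  simp_rw [← Finset.mul_sum, hP.sum_eq_one x _ hx, mul_one]
  exact (hπ x).2

lemma sum_pathProb_mul_snoc (hP : IsTransition G P) (hπ : IsPolicy π) {n : ℕ} (hn : n < L)
    (f : Traj S A n → ℝ) :
    ∑ σ : Traj S A n, ∑ a, ∑ x, pathProb G.start P π (σ.snoc a x) * f σ =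
      ∑ σ, pathProb G.start P π σ * f σ := by
  refine Finset.sum_congr rfl fun σ _ => ?_
  simp only [pathProb_snoc]
  -- Rows of `P` are only known to sum to one below layer `L`. A path of positive probability ends
  -- in layer `n < L`, so its extra step integrates to one.
  by_cases h : pathProb G.start P π σ = 0
  · simp [h]
  have hl := layer_of_pathProb_ne_zero hP h (Fin.last n)
  have := sum_policy_mul_transition hP hπ (x := σ.1 (Fin.last n)) (by simpa [hl] using hn)
  calc _ = (pathProb G.start P π σ * f σ) *
        ∑ a, ∑ x', π (σ.1 (Fin.last n)) a * P (σ.1 (Fin.last n)) a x' := by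
        simp only [Finset.mul_sum]
        refine Finset.sum_congr rfl fun a _ => Finset.sum_congr rfl fun x _ => by ring
    _ = _ := by rw [this, mul_one]

/-- The joint law of a state, the action and the next state. -/
lemma sum_pathProb_mul_step (hP : IsTransition G P) (hπ : IsPolicy π) {n : ℕ} (hn : n ≤ L)
    (h : Fin n) (f : S → A → S → ℝ) :
    ∑ σ : Traj S A n, pathProb G.start P π σ * f (σ.1 h.castSucc) (σ.2 h) (σ.1 h.succ) =
      ∑ x, ∑ a, ∑ x', marg G.start P π h x * (π x a * P x a x' * f x a x') := by
  induction n with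
  | zero => exact h.elim0
  | succ n ih =>
    rw [sum_traj_succ]
    refine Fin.lastCases ?_ (fun j => ?_) h
    · simp only [Traj.snoc_fst_castSucc, Traj.snoc_snd_last, Fin.succ_last, Traj.snoc_fst_last,
        pathProb_snoc, mul_assoc, Fin.val_last]
      simp only [← Finset.mul_sum]
      exact sum_pathProb_mul_last G.start P π n (fun y => ∑ a, π y a * ∑ x', P y a x' * f y a x')
    · simp only [Traj.snoc_fst_castSucc, Traj.snoc_snd_castSucc, Fin.succ_castSucc,
        Fin.val_castSucc]
      rw [sum_pathProb_mul_snoc hP hπ hn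
        (fun σ => f (σ.1 j.castSucc) (σ.2 j) (σ.1 j.succ))]
      exact ih (by omega) j

lemma sum_pathProb (hP : IsTransition G P) (hπ : IsPolicy π) {n : ℕ} (hn : n ≤ L) :
    ∑ σ : Traj S A n, pathProb G.start P π σ = 1 := by
  induction n with
  | zero =>
    have := sum_pathProb_mul_last G.start P π 0 (fun _ => 1)
    simpa [marg] using this
  | succ n ih =>
    rw [sum_traj_succ]
    have := sum_pathProb_mul_snoc hP hπ hn (fun _ => 1)
    simp only [mul_one] at this
    rw [this, ih (by omega)]

lemma marg_nonneg (hP : IsTransition G P) (hπ : IsPolicy π) (s₀ : S) (n : ℕ) (x : S) :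
    0 ≤ marg s₀ P π n x := by
  induction n generalizing x with
  | zero => simp only [marg]; split_ifs <;> norm_num
  | succ n ih =>
    exact Finset.sum_nonneg fun y _ => Finset.sum_nonneg fun a _ =>
      mul_nonneg (mul_nonneg (ih y) ((hπ _).1 _)) (hP.nonneg _ _ _)

lemma sum_marg (hP : IsTransition G P) (hπ : IsPolicy π) {n : ℕ} (hn : n ≤ L) :
    ∑ x, marg G.start P π n x = 1 := by
  have := sum_pathProb_mul_last G.start P π n (fun _ => 1)
  simp only [mul_one] at this
  rw [← this, sum_pathProb hP hπ hn]

lemma layer_of_marg_ne_zero (hP : IsTransition G P) {n : ℕ} {x : S}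
    (h : marg G.start P π n x ≠ 0) : G.layer x = n := by
  induction n generalizing x with
  | zero =>
    rw [G.layer_eq_zero_iff]
    by_contra hx
    exact h (by simp [marg, hx])
  | succ n ih =>
    obtain ⟨y, -, hy⟩ := Finset.exists_ne_zero_of_sum_ne_zero h
    obtain ⟨a, -, ha⟩ := Finset.exists_ne_zero_of_sum_ne_zero hy
    have h1 := ih (left_ne_zero_of_mul (left_ne_zero_of_mul ha))
    by_contra h2
    exact right_ne_zero_of_mul ha (hP.layered _ _ _ (by rwa [h1]))

end Marginal

/-! ### Expected cumulative payoffs and occupancy measures -/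

section Payoff

variable [Fintype S] [DecidableEq S] [Fintype A]

/-- The expected sum over an episode of the payoffs `f x a`. -/
def payoff (G : LayeredSpace S L) (P : S → A → S → ℝ) (π : S → A → ℝ) (f : S → A → ℝ) : ℝ :=
  ∑ h ∈ Finset.range L, ∑ x, ∑ a, marg G.start P π h x * (π x a * f x a)

variable {G : LayeredSpace S L} {P : S → A → S → ℝ} {π : S → A → ℝ}

lemma sum_transition_mul (hP : IsTransition G P) {h : ℕ} (hh : h < L) (x : S) (a : A) (c : ℝ) :
    ∑ x', marg G.start P π h x * (π x a * P x a x' * c) =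
      marg G.start P π h x * (π x a * c) := by
  by_cases h0 : marg G.start P π h x = 0
  · simp [h0]
  have hl := layer_of_marg_ne_zero hP h0
  have h1 := hP.sum_eq_one x a (by omega)
  calc _ = (marg G.start P π h x * (π x a * c)) * ∑ x', P x a x' := by
        rw [Finset.mul_sum]
        exact Finset.sum_congr rfl fun x' _ => by ring
    _ = _ := by rw [h1, mul_one]

lemma sum_trajProb_mul_eq_payoff (hP : IsTransition G P) (hπ : IsPolicy π) (f : S → A → ℝ) :
    ∑ σ : Traj S A L, trajProb G P π σ * ∑ h : Fin L, f (σ.1 h.castSucc) (σ.2 h) =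
      payoff G P π f := by
  unfold payoff
  rw [Finset.sum_range]
  simp only [Finset.mul_sum]
  rw [Finset.sum_comm]
  refine Finset.sum_congr rfl fun h _ => ?_
  have := sum_pathProb_mul_step hP hπ le_rfl h (fun x a _ => f x a)
  refine this.trans ?_
  refine Finset.sum_congr rfl fun x _ => Finset.sum_congr rfl fun a _ => ?_
  exact sum_transition_mul hP h.2 x a _

/-- This makes the LP objective an expected payoff. On a path of positive probability the time index
always equals the layer, so the layer condition inside `occ` removes nothing. -/
lemma sum_occ_mul_eq_payoff [DecidableEq A] (hP : IsTransition G P) (hπ : IsPolicy π)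
    (f : S → A → ℝ) :
    ∑ x, ∑ a, ∑ x', occ G P π x a x' * f x a = payoff G P π f := by
  rw [← sum_trajProb_mul_eq_payoff hP hπ f]
  have h1 : ∀ σ : Traj S A L, trajProb G P π σ * ∑ h : Fin L, f (σ.1 h.castSucc) (σ.2 h) =
      ∑ x, ∑ a, ∑ x', trajProb G P π σ * (∑ h : Fin L,
        if (h : ℕ) = G.layer x ∧ σ.1 h.castSucc = x ∧ σ.2 h = a ∧ σ.1 h.succ = x'
          then 1 else 0) * f x a := by
    intro σ
    by_cases h0 : trajProb G P π σ = 0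
    · simp [h0]
    have hl := fun h : Fin L => layer_of_pathProb_ne_zero hP h0 h.castSucc
    simp only [Finset.mul_sum, Finset.sum_mul]
    simp only [Finset.sum_comm (s := Finset.univ (α := S)) (t := Finset.univ (α := Fin L)),
      Finset.sum_comm (s := Finset.univ (α := A)) (t := Finset.univ (α := Fin L))]
    refine Finset.sum_congr rfl fun h _ => ?_
    rw [Finset.sum_eq_single (σ.1 h.castSucc) (fun x _ hx => ?_) (by simp),
      Finset.sum_eq_single (σ.2 h) (fun a _ ha => ?_) (by simp),
      Finset.sum_eq_single (σ.1 h.succ) (fun x' _ hx => ?_) (by simp)]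
    · simp [hl]
    · simp [Ne.symm hx]
    · simp [Ne.symm ha]
    · simp [Ne.symm hx]
  simp only [h1, occ, Finset.sum_mul]
  simp_rw [Finset.sum_comm (s := Finset.univ (α := S)) (t := Finset.univ (α := Traj S A L)),
    Finset.sum_comm (s := Finset.univ (α := A)) (t := Finset.univ (α := Traj S A L)),
    Finset.sum_comm (s := Finset.univ (α := S)) (t := Finset.univ (α := Traj S A L))]

end Payoff

end UCRLLP

namespace UCRLLP

variable {S : Type u} {A : Type v} {L : ℕ}

/-! ### Induced policies and the change of the transition function -/

section Compare

variable [Fintype S] [DecidableEq S] [Fintype A] {G : LayeredSpace S L} {P P' : S → A → S → ℝ}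
  {π π' : S → A → ℝ}

lemma payoff_mono (hP : IsTransition G P) (hπ : IsPolicy π) {f g : S → A → ℝ}
    (hfg : ∀ x, G.layer x < L → ∀ a, f x a ≤ g x a) : payoff G P π f ≤ payoff G P π g := by
  refine Finset.sum_le_sum fun h hh => Finset.sum_le_sum fun x _ => Finset.sum_le_sum fun a _ => ?_
  by_cases h0 : marg G.start P π h x = 0
  · simp [h0]
  have hl := layer_of_marg_ne_zero hP h0
  have hh := Finset.mem_range.1 hh
  exact mul_le_mul_of_nonneg_left (mul_le_mul_of_nonneg_left (hfg x (by omega) a) ((hπ x).1 a))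
    (marg_nonneg hP hπ _ _ _)

lemma payoff_add (f g : S → A → ℝ) :
    payoff G P π (fun x a => f x a + g x a) = payoff G P π f + payoff G P π g := by
  simp only [payoff, mul_add, Finset.sum_add_distrib]

lemma payoff_const_mul (c : ℝ) (f : S → A → ℝ) :
    payoff G P π (fun x a => c * f x a) = c * payoff G P π f := by
  simp only [payoff, Finset.mul_sum]
  refine Finset.sum_congr rfl fun h _ => Finset.sum_congr rfl fun x _ =>
    Finset.sum_congr rfl fun a _ => by ring

lemma sum_marg_mul_policy (hP : IsTransition G P) (hπ : IsPolicy π) {h : ℕ} (hh : h ≤ L) :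
    ∑ x, ∑ a, marg G.start P π h x * π x a = 1 := by
  simp_rw [← Finset.mul_sum, (hπ _).2, mul_one]
  exact sum_marg hP hπ hh

lemma payoff_nonneg (hP : IsTransition G P) (hπ : IsPolicy π) {f : S → A → ℝ}
    (hf : ∀ x a, 0 ≤ f x a) : 0 ≤ payoff G P π f :=
  Finset.sum_nonneg fun _ _ => Finset.sum_nonneg fun x _ => Finset.sum_nonneg fun a _ =>
    mul_nonneg (marg_nonneg hP hπ _ _ _) (mul_nonneg ((hπ x).1 a) (hf x a))

/-- Duality with payoffs: the indicator of `(x, a)` is used as payoff function, and only the term at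
time `G.layer x` survives. -/
lemma sum_occ [DecidableEq A] (hP : IsTransition G P) (hπ : IsPolicy π) {x : S}
    (hx : G.layer x < L) (a : A) :
    ∑ x', occ G P π x a x' = marg G.start P π (G.layer x) x * π x a := by
  have h := sum_occ_mul_eq_payoff hP hπ (fun y b => if y = x ∧ b = a then (1 : ℝ) else 0)
  have h1 : ∑ y, ∑ b, ∑ x', occ G P π y b x' * (if y = x ∧ b = a then (1 : ℝ) else 0) =
      ∑ x', occ G P π x a x' := by
    rw [Finset.sum_eq_single x (fun y _ hy => by simp [hy]) (by simp),
      Finset.sum_eq_single a (fun y _ hy => by simp [hy]) (by simp)]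
    simp
  rw [← h1, h, payoff, Finset.sum_eq_single (G.layer x)]
  · rw [Finset.sum_eq_single x (fun y _ hy => by simp [hy]) (by simp),
      Finset.sum_eq_single a (fun y _ hy => by simp [hy]) (by simp)]
    simp
  · intro h _ hne
    rw [Finset.sum_eq_single x (fun y _ hy => by simp [hy]) (by simp),
      Finset.sum_eq_single a (fun y _ hy => by simp [hy]) (by simp)]
    by_cases h0 : marg G.start P π h x = 0
    · simp [h0]
    exact absurd (layer_of_marg_ne_zero hP h0).symm hne
  · simp [hx]

/-- An induced policy is arbitrary where the occupancy measure vanishes, but those states carry no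
mass. Hence the two policies agree after weighting by the state distribution, which is enough to
propagate marginals and payoffs. -/
lemma marg_mul_policy_of_induces [DecidableEq A] (hP : IsTransition G P) (hπ' : IsPolicy π')
    (h : Induces (occ G P π') π) {n : ℕ} (hn : n < L) (x : S) (a : A) :
    marg G.start P π' n x * π x a = marg G.start P π' n x * π' x a := by
  by_cases h0 : marg G.start P π' n x = 0
  · simp [h0]
  have hl := layer_of_marg_ne_zero hP h0
  have hx : G.layer x < L := by omega
  have hs : ∑ b, ∑ x', occ G P π' x b x' = marg G.start P π' n x := by
    simp_rw [sum_occ hP hπ' hx, hl, ← Finset.mul_sum, (hπ' x).2, mul_one]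
  rw [h.2 x (by rwa [hs]) a, hs, sum_occ hP hπ' hx, hl]
  field_simp

lemma marg_of_induces [DecidableEq A] (hP : IsTransition G P) (hπ' : IsPolicy π')
    (h : Induces (occ G P π') π) {n : ℕ} (hn : n ≤ L) :
    marg G.start P π n = marg G.start P π' n := by
  induction n with
  | zero => rfl
  | succ n ih =>
    funext x'
    simp only [marg, ih (by omega), marg_mul_policy_of_induces hP hπ' h hn]

lemma payoff_of_induces [DecidableEq A] (hP : IsTransition G P) (hπ' : IsPolicy π')
    (h : Induces (occ G P π') π) (f : S → A → ℝ) : payoff G P π f = payoff G P π' f := by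
  unfold payoff
  refine Finset.sum_congr rfl fun n hn => ?_
  have hn := Finset.mem_range.1 hn
  simp only [marg_of_induces hP hπ' h hn.le, ← mul_assoc, marg_mul_policy_of_induces hP hπ' h hn]

omit [DecidableEq S] [Fintype A] in
lemma sum_transition_le_one (hP : IsTransition G P) (x : S) (a : A) : ∑ x', P x a x' ≤ 1 := by
  by_cases hx : G.layer x < L
  · exact (hP.sum_eq_one x a hx).le
  · have h0 : ∀ x' ∈ Finset.univ, P x a x' = 0 := fun x' _ => hP.layered x a x' (by
      have := G.layer_le x'
      omega)
    rw [Finset.sum_eq_zero h0]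
    exact zero_le_one

/-- The distance of the state distributions under two transition functions. -/
lemma sum_abs_marg_sub_le (hP : IsTransition G P) (hP' : IsTransition G P') (hπ : IsPolicy π)
    (n : ℕ) :
    ∑ x, |marg G.start P' π n x - marg G.start P π n x| ≤
      ∑ h ∈ Finset.range n, ∑ x, ∑ a, marg G.start P π h x *
        (π x a * ∑ x', |P' x a x' - P x a x'|) := by
  induction n with
  | zero => simp [marg]
  | succ n ih =>
    rw [Finset.sum_range_succ]
    refine le_trans ?_ (add_le_add_left ih _)
    set m' := marg G.start P' π n
    set m := marg G.start P π n
    have h1 : ∀ x', |marg G.start P' π (n + 1) x' - marg G.start P π (n + 1) x'| ≤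
        ∑ x, ∑ a, (|m' x - m x| * (π x a * P' x a x') +
          m x * (π x a * |P' x a x' - P x a x'|)) := by
      intro x'
      simp only [marg, ← Finset.sum_sub_distrib]
      refine (Finset.abs_sum_le_sum_abs _ _).trans (Finset.sum_le_sum fun x _ => ?_)
      refine (Finset.abs_sum_le_sum_abs _ _).trans (Finset.sum_le_sum fun a _ => ?_)
      have e : m' x * π x a * P' x a x' - m x * π x a * P x a x' =
          (m' x - m x) * (π x a * P' x a x') + m x * (π x a * (P' x a x' - P x a x')) := by ring
      rw [e]
      refine (abs_add_le _ _).trans (le_of_eq ?_)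
      rw [abs_mul, abs_mul (m x), abs_mul (π x a) (P' x a x' - P x a x'),
        abs_of_nonneg (marg_nonneg hP hπ _ _ _ : 0 ≤ m x), abs_of_nonneg ((hπ x).1 a),
        abs_of_nonneg (mul_nonneg ((hπ x).1 a) (hP'.nonneg x a x'))]
    refine (Finset.sum_le_sum fun x' _ => h1 x').trans ?_
    rw [Finset.sum_comm]
    rw [← Finset.sum_add_distrib]
    refine Finset.sum_le_sum fun x _ => ?_
    rw [Finset.sum_comm]
    have h2 : ∑ a, π x a * ∑ x', P' x a x' ≤ 1 := by
      rw [← (hπ x).2]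
      exact Finset.sum_le_sum fun a _ =>
        mul_le_of_le_one_right ((hπ x).1 a) (sum_transition_le_one hP' x a)
    have h3 := mul_le_mul_of_nonneg_left h2 (abs_nonneg (m' x - m x))
    rw [mul_one] at h3
    refine le_trans (le_of_eq ?_) (add_le_add_left h3 _)
    simp only [Finset.sum_add_distrib, Finset.mul_sum]

/-- With payoffs in `[0,1]`, each layer loses at most the `ℓ¹` distance of the state distributions
there, which is bounded by the accumulated error of the whole episode. Summing over layers produces
the factor `L`. -/
lemma payoff_le_of_transition (hP : IsTransition G P) (hP' : IsTransition G P')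
    (hπ : IsPolicy π) {f : S → A → ℝ} (hf0 : ∀ x a, 0 ≤ f x a) (hf1 : ∀ x a, f x a ≤ 1) :
    payoff G P' π f ≤ payoff G P π f +
      L * payoff G P π (fun x a => ∑ x', |P' x a x' - P x a x'|) := by
  have key : ∀ h ∈ Finset.range L, ∑ x, ∑ a, marg G.start P' π h x * (π x a * f x a) ≤
      ∑ x, ∑ a, marg G.start P π h x * (π x a * f x a) +
        payoff G P π (fun x a => ∑ x', |P' x a x' - P x a x'|) := by
    intro h hh
    have hd := sum_abs_marg_sub_le hP hP' hπ h
    have hm : (∑ k ∈ Finset.range h, ∑ x, ∑ a, marg G.start P π k x *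
        (π x a * ∑ x', |P' x a x' - P x a x'|)) ≤
        payoff G P π (fun x a => ∑ x', |P' x a x' - P x a x'|) := by
      refine Finset.sum_le_sum_of_subset_of_nonneg
        (Finset.range_mono (Finset.mem_range.1 hh).le) fun k _ _ => ?_
      exact Finset.sum_nonneg fun x _ => Finset.sum_nonneg fun a _ =>
        mul_nonneg (marg_nonneg hP hπ _ _ _) (mul_nonneg ((hπ x).1 a)
          (Finset.sum_nonneg fun _ _ => abs_nonneg _))
    refine le_trans ?_ (add_le_add_right (hd.trans hm) _)
    rw [← Finset.sum_add_distrib]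
    refine Finset.sum_le_sum fun x _ => ?_
    simp_rw [← Finset.mul_sum]
    have h0 : 0 ≤ ∑ a, π x a * f x a :=
      Finset.sum_nonneg fun a _ => mul_nonneg ((hπ x).1 a) (hf0 x a)
    have h1 : ∑ a, π x a * f x a ≤ 1 := by
      rw [← (hπ x).2]
      exact Finset.sum_le_sum fun a _ => mul_le_of_le_one_right ((hπ x).1 a) (hf1 x a)
    have h2 := le_abs_self (marg G.start P' π h x - marg G.start P π h x)
    have h3 := abs_nonneg (marg G.start P' π h x - marg G.start P π h x)
    nlinarith
  refine (Finset.sum_le_sum key).trans (le_of_eq ?_)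
  rw [Finset.sum_add_distrib]
  simp [payoff]

/-- Optimism: the regret of a policy induced by an optimistic occupancy measure is controlled by
the widths of the confidence intervals along the policy. -/
lemma payoff_sub_le_of_optimistic [DecidableEq A] (hL : 1 ≤ L) {Ps : Set (S → A → S → ℝ)}
    {Pbar : S → A → S → ℝ} {ε b r rhat : S → A → ℝ} {q : S → A → S → ℝ} {πs : S → A → ℝ}
    (hPs : ∀ P' ∈ Ps, IsTransition G P' ∧ ∀ x a, ∑ x', |P' x a x' - Pbar x a x'| ≤ ε x a)
    (hP : P ∈ Ps) (hr0 : ∀ x a, 0 ≤ r x a)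
    (hr : ∀ x a, r x a ≤ rhat x a) (hr1 : ∀ x a, rhat x a ≤ 1)
    (hrb : ∀ x a, rhat x a ≤ r x a + 2 * b x a)
    (hb : ∀ x, G.layer x < L → ∀ a, b x a ≤ ε x a)
    (hq : q ∈ occSet G Ps)
    (hmax : IsMaxOn (fun q' => ∑ x, ∑ a, ∑ x', q' x a x' * rhat x a) (occSet G Ps) q)
    (hπ : Induces q π) (hπs : IsPolicy πs) :
    payoff G P πs r - payoff G P π r ≤ 4 * L * payoff G P π (fun x a => min 1 (ε x a)) := by
  have hPt := (hPs P hP).1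
  obtain ⟨P', hP', π', hπ', rfl⟩ := hq
  have hPt' := (hPs P' hP').1
  have h1 : payoff G P πs r ≤ payoff G P πs rhat := payoff_mono hPt hπs fun x _ a => hr x a
  have h2 : payoff G P πs rhat ≤ payoff G P' π' rhat := by
    rw [← sum_occ_mul_eq_payoff hPt hπs, ← sum_occ_mul_eq_payoff hPt' hπ']
    exact hmax ⟨P, hP, πs, hπs, rfl⟩
  rw [← payoff_of_induces hPt' hπ' hπ] at h2
  have h3 := payoff_le_of_transition hPt hPt' hπ.1 (f := rhat)
    (fun x a => (hr0 x a).trans (hr x a)) hr1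
  -- Both kernels lie within `ε` of the common centre `Pbar`, hence within `2ε` of each other. Being
  -- sub-stochastic they are also within 2, which permits clipping at 1.
  have h4 : payoff G P π (fun x a => ∑ x', |P' x a x' - P x a x'|) ≤
      payoff G P π (fun x a => 2 * min 1 (ε x a)) := by
    refine payoff_mono hPt hπ.1 fun x _ a => ?_
    have e1 := (hPs P hP).2 x a
    have e2 := (hPs P' hP').2 x a
    have e3 : ∑ x', |P' x a x' - P x a x'| ≤ 1 + 1 := by
      refine le_trans ?_ (add_le_add (sum_transition_le_one hPt' x a)
        (sum_transition_le_one hPt x a))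
      rw [← Finset.sum_add_distrib]
      refine Finset.sum_le_sum fun x' _ => ?_
      have := hPt.nonneg x a x'
      have := hPt'.nonneg x a x'
      rw [abs_le]
      constructor <;> linarith
    have e4 : ∑ x', |P' x a x' - P x a x'| ≤ ε x a + ε x a := by
      refine le_trans ?_ (add_le_add e2 e1)
      rw [← Finset.sum_add_distrib]
      refine Finset.sum_le_sum fun x' _ => ?_
      rw [abs_sub_comm (P x a x')]
      exact abs_sub_le _ _ _
    rcases le_total 1 (ε x a) with h | h
    · rw [min_eq_left h]; linarith
    · rw [min_eq_right h]; linarith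
  have h5 : payoff G P π rhat ≤ payoff G P π (fun x a => r x a + 2 * min 1 (ε x a)) := by
    refine payoff_mono hPt hπ.1 fun x hx a => ?_
    have e1 := hb x hx a
    have e2 := hrb x a
    have e3 := hr1 x a
    have e4 := hr0 x a
    rcases le_total 1 (ε x a) with h | h
    · rw [min_eq_left h]; linarith
    · rw [min_eq_right h]; linarith
  rw [payoff_add, payoff_const_mul] at h5
  rw [payoff_const_mul] at h4
  have hLr : (1 : ℝ) ≤ L := by exact_mod_cast hL
  have h6 : 0 ≤ payoff G P π (fun x a => min 1 (ε x a)) := payoff_nonneg hPt hπ.1 fun x a =>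
    le_min zero_le_one ((Finset.sum_nonneg fun _ _ => abs_nonneg _).trans ((hPs P hP).2 x a))
  have h7 := mul_le_mul_of_nonneg_left h4 (by linarith : (0 : ℝ) ≤ L)
  -- Transitions contribute `2L` and rewards `2`. The total is at most `4L` because `L ≥ 1`.
  nlinarith

end Compare

end UCRLLP

namespace UCRLLP

variable {S : Type u} {A : Type v} {L : ℕ}

/-! ### The law of an episode and exponential supermartingales -/

section Law

variable [Fintype S] [DecidableEq S] [Fintype A] [DecidableEq A]
  {M : LayeredMDP S A L} {T : ℕ} {δ : ℝ} {m : ℕ}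
  {Ω : Type w} [mΩ : MeasurableSpace Ω] {μ : Measure Ω}
  {ℱ : Filtration ℕ mΩ} {τ : ℕ → Ω → Traj S A L} {ρ : ℕ → Ω → Fin L → ℝ}
  {q : ℕ → Ω → S → A → S → ℝ} {π : ℕ → Ω → S → A → ℝ}

instance (M : LayeredMDP S A L) (x : S) (a : A) : IsProbabilityMeasure (M.rewardLaw x a) :=
  M.isProbabilityMeasure_rewardLaw x a

/-- The law of the rewards given the trajectory. -/
def LayeredMDP.rewardsLaw (M : LayeredMDP S A L) (σ : Traj S A L) : Measure (Fin L → ℝ) :=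
  Measure.pi fun h : Fin L => M.rewardLaw (σ.1 h.castSucc) (σ.2 h)

instance (M : LayeredMDP S A L) (σ : Traj S A L) : IsProbabilityMeasure (M.rewardsLaw σ) := by
  unfold LayeredMDP.rewardsLaw
  infer_instance

omit [DecidableEq A] in
lemma LayeredMDP.trajProb_nonneg (M : LayeredMDP S A L) {π : S → A → ℝ} (hπ : IsPolicy π)
    (σ : Traj S A L) : 0 ≤ trajProb M.toLayeredSpace M.P π σ :=
  pathProb_nonneg M.isTransition hπ _ σ

lemma IsRun.isPolicy (hrun : IsRun M T δ m μ ℱ τ ρ q π) {t : ℕ} (ht : t < T) :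
    ∀ᵐ ω ∂μ, IsPolicy (π t ω) :=
  (hrun.induces t ht).mono fun _ h => h.1

lemma IsRun.measurable_trajProb (hrun : IsRun M T δ m μ ℱ τ ρ q π) {t : ℕ} (ht : t < T)
    (σ : Traj S A L) :
    Measurable[ℱ t] fun ω => trajProb M.toLayeredSpace M.P (π t ω) σ := by
  unfold trajProb
  refine Measurable.const_mul ?_ _
  refine Finset.measurable_prod _ fun h _ => ?_
  refine Measurable.mul_const ?_ _
  exact (measurable_pi_apply _).comp ((measurable_pi_apply _).comp (hrun.measurable_policy t ht))

lemma IsRun.measurableSet_traj (hrun : IsRun M T δ m μ ℱ τ ρ q π) {t : ℕ} (ht : t < T)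
    (σ : Traj S A L) : MeasurableSet {ω | τ t ω = σ} :=
  ℱ.le _ _ (hrun.measurable_traj t ht σ)

variable [IsProbabilityMeasure μ]

/-- The conditional law of an episode in integrated form. It turns the `condExp` identity into an
equality of measures that can be extended to general integrands. -/
lemma IsRun.measure_inter (hrun : IsRun M T δ m μ ℱ τ ρ q π) {t : ℕ} (ht : t < T)
    {E : Set Ω} (hE : MeasurableSet[ℱ t] E) (σ : Traj S A L) {B : Set (Fin L → ℝ)}
    (hB : MeasurableSet B) :
    μ (E ∩ {ω | τ t ω = σ ∧ ρ t ω ∈ B}) =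
      ∫⁻ ω in E, ENNReal.ofReal (trajProb M.toLayeredSpace M.P (π t ω) σ) *
        M.rewardsLaw σ B ∂μ := by
  have hE' := ℱ.le t _ hE
  have hD : MeasurableSet {ω | τ t ω = σ ∧ ρ t ω ∈ B} :=
    (hrun.measurableSet_traj ht σ).inter
      (((hrun.measurable_rewards t ht).mono (ℱ.le _) le_rfl) hB)
  have hlaw := hrun.law t ht σ B hB
  have hint : Integrable ({ω | τ t ω = σ ∧ ρ t ω ∈ B}.indicator fun _ => (1 : ℝ)) μ :=
    (integrable_const 1).indicator hD
  have h1 := setIntegral_condExp (ℱ.le t) hint hE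
  have h2 : ∫ ω in E, {ω | τ t ω = σ ∧ ρ t ω ∈ B}.indicator (fun _ => (1 : ℝ)) ω ∂μ =
      μ.real (E ∩ {ω | τ t ω = σ ∧ ρ t ω ∈ B}) := by
    rw [integral_indicator hD, Measure.restrict_restrict hD, Set.inter_comm]
    simp
  rw [h2, setIntegral_congr_ae hE' (hlaw.mono fun ω h _ => h)] at h1
  rw [← ENNReal.ofReal_toReal (measure_ne_top μ (E ∩ _))]
  change ENNReal.ofReal (μ.real _) = _
  rw [← h1, ofReal_integral_eq_lintegral_ofReal]
  · refine lintegral_congr_ae (ae_restrict_of_ae ((hrun.isPolicy ht).mono fun ω hω => ?_))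
    simp only
    rw [ENNReal.ofReal_mul (M.trajProb_nonneg hω σ), Measure.real,
      ENNReal.ofReal_toReal (measure_ne_top _ _)]
    rfl
  · exact ((integrable_condExp (m := ℱ t)).congr hlaw).integrableOn
  · exact ae_restrict_of_ae ((hrun.isPolicy ht).mono fun ω hω =>
      mul_nonneg (M.trajProb_nonneg hω σ) measureReal_nonneg)

lemma IsRun.lintegral_mul_indicator (hrun : IsRun M T δ m μ ℱ τ ρ q π) {t : ℕ} (ht : t < T)
    {W : Ω → ENNReal} (hW : Measurable[ℱ t] W) (σ : Traj S A L) {ψ : (Fin L → ℝ) → ENNReal}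
    (hψ : Measurable ψ) :
    ∫⁻ ω, {ω | τ t ω = σ}.indicator (fun ω => W ω * ψ (ρ t ω)) ω ∂μ =
      (∫⁻ ω, W ω * ENNReal.ofReal (trajProb M.toLayeredSpace M.P (π t ω) σ) ∂μ) *
        ∫⁻ y, ψ y ∂M.rewardsLaw σ := by
  have hW' : Measurable W := hW.mono (ℱ.le t) le_rfl
  have hρ : Measurable (ρ t) := (hrun.measurable_rewards t ht).mono (ℱ.le _) le_rfl
  have hσ := hrun.measurableSet_traj ht σ
  have hp : Measurable fun ω => ENNReal.ofReal (trajProb M.toLayeredSpace M.P (π t ω) σ) :=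
    ((hrun.measurable_trajProb ht σ).mono (ℱ.le t) le_rfl).ennreal_ofReal
  have hWp : Measurable fun ω =>
      W ω * ENNReal.ofReal (trajProb M.toLayeredSpace M.P (π t ω) σ) := hW'.mul hp
  have h1 : ∀ B, MeasurableSet B → ∫⁻ ω in {ω | τ t ω = σ ∧ ρ t ω ∈ B}, W ω ∂μ =
      (∫⁻ ω, W ω * ENNReal.ofReal (trajProb M.toLayeredSpace M.P (π t ω) σ) ∂μ) *
        M.rewardsLaw σ B := by
    intro B hB
    have hD : MeasurableSet {ω | τ t ω = σ ∧ ρ t ω ∈ B} := hσ.inter (hρ hB)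
    -- Two measures that agree on `ℱ t` give the same integral to the `ℱ t`-measurable `W`. This
    -- passes from indicators of past events to arbitrary weights.
    have e : (μ.restrict {ω | τ t ω = σ ∧ ρ t ω ∈ B}).trim (ℱ.le t) =
        (μ.withDensity fun ω => ENNReal.ofReal (trajProb M.toLayeredSpace M.P (π t ω) σ) *
          M.rewardsLaw σ B).trim (ℱ.le t) := by
      refine @Measure.ext _ (ℱ t) _ _ fun E hE => ?_
      rw [trim_measurableSet_eq _ hE, trim_measurableSet_eq _ hE,
        Measure.restrict_apply (ℱ.le t _ hE), withDensity_apply _ (ℱ.le t _ hE),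
        hrun.measure_inter ht hE σ hB]
    have h := congrArg (fun ν => @lintegral _ (ℱ t) ν W) e
    simp only [lintegral_trim _ hW] at h
    rw [h, lintegral_withDensity_eq_lintegral_mul _ (hp.mul_const _) hW',
      ← lintegral_mul_const _ hWp]
    refine lintegral_congr fun ω => ?_
    simp only [Pi.mul_apply]
    ring
  -- Now the reward event is generalized: the weighted law of the rewards on this trajectory is a
  -- multiple of the product law, so any measurable `ψ` may be integrated.
  have h2 : ((μ.restrict {ω | τ t ω = σ}).withDensity W).map (ρ t) =
      (∫⁻ ω, W ω * ENNReal.ofReal (trajProb M.toLayeredSpace M.P (π t ω) σ) ∂μ) •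
        M.rewardsLaw σ := by
    refine Measure.ext fun B hB => ?_
    rw [Measure.map_apply hρ hB, withDensity_apply _ (hρ hB),
      Measure.restrict_restrict (hρ hB), Measure.smul_apply, smul_eq_mul, ← h1 B hB]
    congr 2
    ext ω
    simp [and_comm]
  rw [lintegral_indicator hσ]
  have hψρ : Measurable fun ω => ψ (ρ t ω) := hψ.comp hρ
  have h3 := congrArg (fun ν => ∫⁻ y, ψ y ∂ν) h2
  rw [lintegral_map hψ hρ, lintegral_withDensity_eq_lintegral_mul _ hW' hψρ,
    lintegral_smul_measure, smul_eq_mul] at h3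
  exact h3

/-- Integrating out one episode. -/
lemma IsRun.lintegral_step_le (hrun : IsRun M T δ m μ ℱ τ ρ q π) {t : ℕ} (ht : t < T)
    {W : Ω → ENNReal} (hW : Measurable[ℱ t] W) {Φ : Ω → Traj S A L → ENNReal}
    (hΦ : ∀ σ, Measurable[ℱ t] fun ω => Φ ω σ) {Ψ : Traj S A L → (Fin L → ℝ) → ENNReal}
    (hΨ : ∀ σ, Measurable (Ψ σ))
    (h : ∀ᵐ ω ∂μ, ∑ σ, ENNReal.ofReal (trajProb M.toLayeredSpace M.P (π t ω) σ) *
      (Φ ω σ * ∫⁻ y, Ψ σ y ∂M.rewardsLaw σ) ≤ 1) :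
    ∫⁻ ω, W ω * (Φ ω (τ t ω) * Ψ (τ t ω) (ρ t ω)) ∂μ ≤ ∫⁻ ω, W ω ∂μ := by
  have hρ : Measurable (ρ t) := (hrun.measurable_rewards t ht).mono (ℱ.le _) le_rfl
  have hWΦ : ∀ σ, Measurable[ℱ t] fun ω => W ω * Φ ω σ := fun σ =>
    hW.mul (hΦ σ)
  have hm : ∀ σ, Measurable fun ω => W ω * Φ ω σ := fun σ => (hWΦ σ).mono (ℱ.le t) le_rfl
  have hp : ∀ σ, Measurable fun ω =>
      ENNReal.ofReal (trajProb M.toLayeredSpace M.P (π t ω) σ) := fun σ =>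
    ((hrun.measurable_trajProb ht σ).mono (ℱ.le t) le_rfl).ennreal_ofReal
  have e : ∀ ω, W ω * (Φ ω (τ t ω) * Ψ (τ t ω) (ρ t ω)) =
      ∑ σ, {ω | τ t ω = σ}.indicator (fun ω => (W ω * Φ ω σ) * Ψ σ (ρ t ω)) ω := by
    intro ω
    rw [Finset.sum_eq_single (τ t ω) (fun σ _ hσ => by simp [Ne.symm hσ]) (by simp)]
    simp [mul_assoc]
  simp_rw [e]
  have hm1 : ∀ σ, Measurable fun ω => W ω * Φ ω σ * Ψ σ (ρ t ω) := fun σ =>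
    (hm σ).mul ((hΨ σ).comp hρ)
  have hm2 : ∀ σ, Measurable fun ω => W ω * Φ ω σ *
      ENNReal.ofReal (trajProb M.toLayeredSpace M.P (π t ω) σ) := fun σ => (hm σ).mul (hp σ)
  rw [lintegral_finsetSum _ fun σ _ => (hm1 σ).indicator (hrun.measurableSet_traj ht σ)]
  simp_rw [hrun.lintegral_mul_indicator ht (hWΦ _) _ (hΨ _)]
  simp_rw [← lintegral_mul_const _ (hm2 _)]
  rw [← lintegral_finsetSum _ fun σ _ => (hm2 σ).mul_const _]
  refine lintegral_mono_ae (h.mono fun ω hω => ?_)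
  calc _ = W ω * ∑ σ, ENNReal.ofReal (trajProb M.toLayeredSpace M.P (π t ω) σ) *
      (Φ ω σ * ∫⁻ y, Ψ σ y ∂M.rewardsLaw σ) := by
        rw [Finset.mul_sum]
        exact Finset.sum_congr rfl fun σ _ => by ring
    _ ≤ W ω := mul_le_of_le_one_right' hω

/-- The Chernoff bound for an exponential supermartingale. -/
lemma measure_sum_ge_le_of_supermartingale (Z : ℕ → Ω → ℝ)
    (hZ : ∀ t < T, Measurable[ℱ (t + 1)] (Z t))
    (hstep : ∀ t < T, ∀ W : Ω → ENNReal, Measurable[ℱ t] W →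
      ∫⁻ ω, W ω * ENNReal.ofReal (Real.exp (Z t ω)) ∂μ ≤ ∫⁻ ω, W ω ∂μ) (u : ℝ) :
    μ {ω | u ≤ ∑ t ∈ Finset.range T, Z t ω} ≤ ENNReal.ofReal (Real.exp (-u)) := by
  have hmeas : ∀ k ≤ T, Measurable[ℱ k] fun ω => ∑ t ∈ Finset.range k, Z t ω := fun k hk =>
    Finset.measurable_sum _ fun t ht =>
      (hZ t ((Finset.mem_range.1 ht).trans_le hk)).mono (ℱ.mono (Finset.mem_range.1 ht)) le_rfl
  have hmeas' : ∀ k ≤ T, Measurable[ℱ k] fun ω =>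
      ENNReal.ofReal (Real.exp (∑ t ∈ Finset.range k, Z t ω)) := fun k hk =>
    (Real.measurable_exp.comp (hmeas k hk)).ennreal_ofReal
  have key : ∀ k ≤ T, ∫⁻ ω, ENNReal.ofReal (Real.exp (∑ t ∈ Finset.range k, Z t ω)) ∂μ ≤ 1 := by
    intro k
    induction k with
    | zero => simp
    | succ k ih =>
      intro hk
      refine le_trans (le_trans (le_of_eq ?_) (hstep k hk _ (hmeas' k (by omega))))
        (ih (by omega))
      refine lintegral_congr fun ω => ?_
      rw [Finset.sum_range_succ, Real.exp_add, ENNReal.ofReal_mul (Real.exp_pos _).le]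
  have h1 := mul_meas_ge_le_lintegral ((hmeas' T le_rfl).mono (ℱ.le T) le_rfl)
    (μ := μ) (ENNReal.ofReal (Real.exp u))
  have h2 : {ω | u ≤ ∑ t ∈ Finset.range T, Z t ω} ⊆ {ω | ENNReal.ofReal (Real.exp u) ≤
      ENNReal.ofReal (Real.exp (∑ t ∈ Finset.range T, Z t ω))} := fun ω hω =>
    ENNReal.ofReal_le_ofReal (Real.exp_le_exp.2 hω)
  have h3 := (mul_le_mul_right (measure_mono h2) _).trans (h1.trans (key T le_rfl))
  rw [Real.exp_neg, ENNReal.ofReal_inv_of_pos (Real.exp_pos u), ← one_div]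
  rw [ENNReal.le_div_iff_mul_le (by simp [Real.exp_pos]) (by simp), mul_comm]
  exact h3

end Law

end UCRLLP

namespace UCRLLP

variable {S : Type u} {A : Type v} {L : ℕ}

/-! ### Hoeffding's lemma -/

lemma lintegral_exp_sub_integral_le {ν : Measure ℝ} [IsProbabilityMeasure ν]
    (hν : ∀ᵐ y ∂ν, y ∈ Set.Icc (0 : ℝ) 1) (c : ℝ) :
    ∫⁻ y, ENNReal.ofReal (Real.exp (c * (y - ∫ z, z ∂ν))) ∂ν ≤
      ENNReal.ofReal (Real.exp (c ^ 2 / 8)) := by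
  have h := hasSubgaussianMGF_of_mem_Icc (μ := ν) (X := fun y => y) aemeasurable_id hν
  rw [← ofReal_integral_eq_lintegral_ofReal (h.integrable_exp_mul c)
    (Filter.Eventually.of_forall fun _ => (Real.exp_pos _).le)]
  refine ENNReal.ofReal_le_ofReal ((h.mgf_le c).trans (le_of_eq ?_))
  simp
  ring

/-- Hoeffding's lemma for the finitely supported law with weights `p`. It is used for next states
and for whole trajectories. -/
lemma sum_mul_exp_sub_le {ι : Type*} [Fintype ι] {p f : ι → ℝ} (hp : ∀ i, 0 ≤ p i)
    (hp1 : ∑ i, p i = 1) {a b : ℝ} (hf : ∀ i, f i ∈ Set.Icc a b) (c : ℝ) :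
    ∑ i, p i * Real.exp (c * (f i - ∑ j, p j * f j)) ≤ Real.exp (c ^ 2 * (b - a) ^ 2 / 8) := by
  let _ : MeasurableSpace ι := ⊤
  have hs : ∑ i, ENNReal.ofReal (p i) = 1 := by
    rw [← ENNReal.ofReal_sum_of_nonneg fun i _ => hp i, hp1, ENNReal.ofReal_one]
  have hint : ∀ g : ι → ℝ, ∫ i, g i ∂(PMF.ofFintype _ hs).toMeasure = ∑ i, p i * g i := by
    intro g
    rw [PMF.integral_eq_sum]
    refine Finset.sum_congr rfl fun i _ => ?_
    simp [PMF.ofFintype_apply, ENNReal.toReal_ofReal (hp i)]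
  have h := hasSubgaussianMGF_of_mem_Icc (μ := (PMF.ofFintype _ hs).toMeasure) (X := f)
    (measurable_of_finite f).aemeasurable (Filter.Eventually.of_forall hf)
  have h1 := h.mgf_le c
  rw [mgf, hint] at h1
  simp only [hint] at h1
  refine h1.trans (le_of_eq ?_)
  simp only [NNReal.coe_pow, NNReal.coe_div, coe_nnnorm, Real.norm_eq_abs, NNReal.coe_ofNat,
    div_pow, sq_abs]
  ring_nf

/-! ### Deviations along the visits to a state-action pair -/

/-- A trajectory that moves through the layers one by one. -/
def LayeredSpace.Valid (G : LayeredSpace S L) (σ : Traj S A L) : Prop :=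
  ∀ i, G.layer (σ.1 i) = i

/-- The trajectory visits the pair `(x, a)` at time `h`. -/
abbrev Traj.VisitsAt (σ : Traj S A L) (h : Fin L) (x : S) (a : A) : Prop :=
  σ.1 h.castSucc = x ∧ σ.2 h = a

/-- A valid trajectory can be at `x` only at time `G.layer x`, so a sum over the steps that meet `x`
has at most one term. -/
lemma LayeredSpace.Valid.sum_ite {G : LayeredSpace S L} {σ : Traj S A L}
    (hσ : G.Valid σ) {h : Fin L} {x : S} (hx : G.layer x = h) {R : Type*} [AddCommMonoid R]
    (p : Fin L → Prop) [DecidablePred p] (hp : ∀ k, p k → σ.1 k.castSucc = x) (f : Fin L → R) :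
    (∑ k, if p k then f k else 0) = if p h then f h else 0 := by
  refine Finset.sum_eq_single h (fun k _ hk => if_neg fun hp' => hk ?_) (by simp)
  have := hσ k.castSucc
  rw [hp k hp', hx] at this
  exact Fin.ext this.symm

section Visits

variable [DecidableEq S] [DecidableEq A] {G : LayeredSpace S L} {τ : ℕ → Traj S A L} {t : ℕ}

lemma numVisits_eq (hτ : ∀ s < t, G.Valid (τ s)) {h : Fin L} {x : S} (hx : G.layer x = h) (a : A) :
    numVisits τ t x a = ∑ s ∈ Finset.range t, if (τ s).VisitsAt h x a then 1 else 0 :=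
  Finset.sum_congr rfl fun s hs =>
    (hτ s (Finset.mem_range.1 hs)).sum_ite hx (fun k => (τ s).VisitsAt k x a) (fun _ hk => hk.1)
      fun _ => 1

lemma numTransitions_eq (hτ : ∀ s < t, G.Valid (τ s)) {h : Fin L} {x : S} (hx : G.layer x = h)
    (a : A) (x' : S) :
    numTransitions τ t x a x' = ∑ s ∈ Finset.range t,
      if (τ s).VisitsAt h x a ∧ (τ s).1 h.succ = x' then 1 else 0 := by
  refine Finset.sum_congr rfl fun s hs => ?_
  simp only [and_assoc]
  exact (hτ s (Finset.mem_range.1 hs)).sum_ite hx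
    (fun k => (τ s).1 k.castSucc = x ∧ (τ s).2 k = a ∧ (τ s).1 k.succ = x') (fun _ hk => hk.1)
      fun _ => 1

lemma sumRewards_eq (hτ : ∀ s < t, G.Valid (τ s)) {h : Fin L} {x : S} (hx : G.layer x = h)
    (a : A) (ρ : ℕ → Fin L → ℝ) :
    sumRewards τ ρ t x a = ∑ s ∈ Finset.range t,
      if (τ s).VisitsAt h x a then ρ s h else 0 :=
  Finset.sum_congr rfl fun s hs =>
    (hτ s (Finset.mem_range.1 hs)).sum_ite hx (fun k => (τ s).VisitsAt k x a) (fun _ hk => hk.1)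
      (ρ s)

lemma numVisits_mono (τ : ℕ → Traj S A L) (x : S) (a : A) : Monotone fun t => numVisits τ t x a :=
  fun _ _ h => Finset.sum_le_sum_of_subset (Finset.range_mono h)

lemma numVisits_of_layer_eq (hτ : ∀ s < t, G.Valid (τ s)) {x : S} (hx : ¬ G.layer x < L) (a : A) :
    numVisits τ t x a = 0 :=
  Finset.sum_eq_zero fun s hs => Finset.sum_eq_zero fun k _ => if_neg fun hk => hx (by
    have := hτ s (Finset.mem_range.1 hs) k.castSucc
    rw [hk.1] at this
    rw [this]
    exact k.2)

lemma numVisits_le (hτ : ∀ s < t, G.Valid (τ s)) (x : S) (a : A) : numVisits τ t x a ≤ t := by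
  by_cases hx : G.layer x < L
  · rw [numVisits_eq hτ (h := ⟨G.layer x, hx⟩) rfl]
    refine (Finset.sum_le_sum (g := fun _ => 1) fun s _ => ?_).trans (by simp)
    split_ifs <;> norm_num
  · rw [numVisits_of_layer_eq hτ hx]
    exact Nat.zero_le t

lemma not_visitsAt_of_numVisits_eq_zero {x : S} {a : A} (h0 : numVisits τ t x a = 0) {s : ℕ}
    (hs : s < t) (k : Fin L) : ¬ (τ s).VisitsAt k x a := by
  unfold numVisits at h0
  simp only [Finset.sum_eq_zero_iff, Finset.mem_range, Finset.mem_univ, true_imp_iff] at h0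
  intro hk
  have := h0 s hs k
  rw [if_pos hk] at this
  exact one_ne_zero this

lemma numTransitions_of_numVisits_eq_zero {x : S} {a : A} (h0 : numVisits τ t x a = 0) (x' : S) :
    numTransitions τ t x a x' = 0 :=
  Finset.sum_eq_zero fun _ hs => Finset.sum_eq_zero fun k _ => if_neg fun hk =>
    not_visitsAt_of_numVisits_eq_zero h0 (Finset.mem_range.1 hs) k ⟨hk.1, hk.2.1⟩

lemma sumRewards_of_numVisits_eq_zero {x : S} {a : A} (h0 : numVisits τ t x a = 0)
    (ρ : ℕ → Fin L → ℝ) : sumRewards τ ρ t x a = 0 :=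
  Finset.sum_eq_zero fun _ hs => Finset.sum_eq_zero fun k _ => if_neg fun hk =>
    not_visitsAt_of_numVisits_eq_zero h0 (Finset.mem_range.1 hs) k hk

/-- Restricting a sum over visits to the first `n` visits. -/
lemma sum_visits_truncate {T : ℕ} (hτ : ∀ s < T, G.Valid (τ s)) {h : Fin L} {x : S}
    (hx : G.layer x = h) (a : A) (ht : t ≤ T) (f : ℕ → ℝ) :
    (∑ s ∈ Finset.range T, if numVisits τ s x a < numVisits τ t x a then
      (if (τ s).VisitsAt h x a then f s else 0) else 0) =
      ∑ s ∈ Finset.range t, if (τ s).VisitsAt h x a then f s else 0 := by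
  rw [← Finset.sum_subset (Finset.range_mono ht)]
  · refine Finset.sum_congr rfl fun s hs => ?_
    have hs := Finset.mem_range.1 hs
    by_cases hv : (τ s).VisitsAt h x a
    -- A visit at `s < t` is itself counted before `t`, so the count at `s` is strictly smaller.
    -- From `t` on the inequality fails. Thus a condition known before episode `s` selects exactly
    -- the visits before `t`.
    · refine if_pos (lt_of_lt_of_le ?_ (numVisits_mono τ x a (Nat.succ_le_of_lt hs)))
      simp only
      rw [numVisits_eq (fun r hr => hτ r (by omega)) hx,
        numVisits_eq (fun r hr => hτ r (by omega)) hx, Finset.sum_range_succ, if_pos hv]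
      omega
    · simp [hv]
  · intro s _ hs
    have := numVisits_mono τ x a (not_lt.1 (Finset.mem_range.not.1 hs))
    exact if_neg (not_lt.2 this)

end Visits

/-! ### Tail bounds for sums over the visits to a pair -/

section Tail

variable [Fintype S] [DecidableEq S] [Fintype A] [DecidableEq A]
  {M : LayeredMDP S A L} {T : ℕ} {δ : ℝ} {m : ℕ}
  {Ω : Type w} [mΩ : MeasurableSpace Ω] {μ : Measure Ω}
  {ℱ : Filtration ℕ mΩ} {τ : ℕ → Ω → Traj S A L} {ρ : ℕ → Ω → Fin L → ℝ}
  {q : ℕ → Ω → S → A → S → ℝ} {π : ℕ → Ω → S → A → ℝ}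

/-- There are finitely many histories of length `t`, and each is an event of `ℱ t`. The preimage of
any set is a union of such events, whatever `F` is. -/
lemma IsRun.measurable_of_traj (hrun : IsRun M T δ m μ ℱ τ ρ q π) {t : ℕ} (ht : t ≤ T)
    {α : Type*} [MeasurableSpace α] (F : (ℕ → Traj S A L) → α)
    (hF : ∀ τ₁ τ₂ : ℕ → Traj S A L, (∀ s < t, τ₁ s = τ₂ s) → F τ₁ = F τ₂) :
    Measurable[ℱ t] fun ω => F fun s => τ s ω := by
  intro B _
  have e : (fun ω => F fun s => τ s ω) ⁻¹' B =
      ⋃ σ : Fin t → Traj S A L, {ω | (∀ s : Fin t, τ s ω = σ s) ∧ (F fun s => τ s ω) ∈ B} := by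
    ext ω
    simp only [Set.mem_preimage, Set.mem_iUnion, Set.mem_ofPred_eq]
    exact ⟨fun h => ⟨fun s => τ s ω, fun _ => rfl, h⟩, fun ⟨_, _, h⟩ => h⟩
  rw [e]
  refine MeasurableSet.iUnion fun σ => ?_
  by_cases h : ∃ ω₀, (∀ s : Fin t, τ s ω₀ = σ s) ∧ (F fun s => τ s ω₀) ∈ B
  · obtain ⟨ω₀, h1, h2⟩ := h
    have e' : {ω | (∀ s : Fin t, τ s ω = σ s) ∧ (F fun s => τ s ω) ∈ B} =
        ⋂ s : Fin t, {ω | τ s ω = σ s} := by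
      ext ω
      simp only [Set.mem_ofPred_eq, Set.mem_iInter]
      refine ⟨fun h => h.1, fun h => ⟨h, ?_⟩⟩
      rwa [hF (fun s => τ s ω) (fun s => τ s ω₀) fun s hs => (h ⟨s, hs⟩).trans (h1 ⟨s, hs⟩).symm]
    rw [e']
    exact MeasurableSet.iInter fun s =>
      ℱ.mono s.2 _ (hrun.measurable_traj s (s.2.trans_le ht) (σ s))
  · convert MeasurableSet.empty
    ext ω
    simpa using fun h1 h2 => h ⟨ω, h1, h2⟩

variable [IsProbabilityMeasure μ]

lemma IsRun.ae_valid (hrun : IsRun M T δ m μ ℱ τ ρ q π) :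
    ∀ᵐ ω ∂μ, ∀ t < T, M.Valid (τ t ω) := by
  refine ae_all_iff.2 fun t => ?_
  by_cases ht : t < T
  swap
  · exact Filter.Eventually.of_forall fun _ h => absurd h ht
  have h : ∀ σ : Traj S A L, ∀ᵐ ω ∂μ, τ t ω = σ → M.Valid σ := by
    intro σ
    by_cases hσ : M.Valid σ
    · exact Filter.Eventually.of_forall fun _ _ => hσ
    have h0 : ∀ ω, trajProb M.toLayeredSpace M.P (π t ω) σ = 0 := fun ω => by
      by_contra h
      exact hσ (layer_of_pathProb_ne_zero M.isTransition h)
    have h1 := hrun.lintegral_mul_indicator ht (W := fun _ => 1) measurable_const σ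
      (ψ := fun _ => 1) measurable_const
    simp only [h0, mul_one, ENNReal.ofReal_zero] at h1
    rw [lintegral_indicator (hrun.measurableSet_traj ht σ)] at h1
    simp only [lintegral_const, Measure.restrict_apply_univ, one_mul, zero_mul] at h1
    refine measure_mono_null (fun ω hω => ?_) h1
    simp only [Set.mem_compl_iff, Set.mem_ofPred_eq] at hω
    by_contra h2
    exact hω fun h3 => absurd h3 h2
  filter_upwards [ae_all_iff.2 h] with ω hω _ using hω _ rfl

/-- Switching increments off by a predictable condition keeps the supermartingale property, since a
switched-off increment contributes the factor 1. -/
lemma IsRun.measure_sum_ite_ge_le (hrun : IsRun M T δ m μ ℱ τ ρ q π) (D : ℕ → Ω → Prop)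
    [∀ s ω, Decidable (D s ω)] (hD : ∀ s < T, MeasurableSet[ℱ s] {ω | D s ω})
    (Y : Traj S A L → (Fin L → ℝ) → ℝ) (hY : ∀ σ, Measurable (Y σ))
    (hexp : ∀ π : S → A → ℝ, IsPolicy π → ∑ σ, ENNReal.ofReal (trajProb M.toLayeredSpace M.P π σ) *
      ∫⁻ y, ENNReal.ofReal (Real.exp (Y σ y)) ∂M.rewardsLaw σ ≤ 1) (u : ℝ) :
    μ {ω | u ≤ ∑ s ∈ Finset.range T, if D s ω then Y (τ s ω) (ρ s ω) else 0} ≤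
      ENNReal.ofReal (Real.exp (-u)) := by
  refine measure_sum_ge_le_of_supermartingale (ℱ := ℱ) _ (fun t ht => ?_) (fun t ht W hW => ?_) u
  · refine Measurable.ite (ℱ.mono (Nat.le_succ t) _ (hD t ht)) ?_ measurable_const
    have e : (fun ω => Y (τ t ω) (ρ t ω)) = fun ω =>
        ∑ σ, {ω | τ t ω = σ}.indicator (fun ω => Y σ (ρ t ω)) ω := by
      funext ω
      rw [Finset.sum_eq_single (τ t ω) (fun σ _ hσ => by simp [Ne.symm hσ]) (by simp)]
      simp
    rw [e]
    exact Finset.measurable_sum _ fun σ _ =>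
      ((hY σ).comp (hrun.measurable_rewards t ht)).indicator (hrun.measurable_traj t ht σ)
  · have hDt := ℱ.le t _ (hD t ht)
    have hW' : Measurable W := hW.mono (ℱ.le t) le_rfl
    have e : ∀ ω, W ω * ENNReal.ofReal (Real.exp (if D t ω then Y (τ t ω) (ρ t ω) else 0)) =
        {ω | D t ω}.indicator W ω * (1 * ENNReal.ofReal (Real.exp (Y (τ t ω) (ρ t ω)))) +
          {ω | D t ω}ᶜ.indicator W ω := by
      intro ω
      by_cases h : D t ω <;> simp [h]
    simp_rw [e]
    rw [lintegral_add_right _ (hW'.indicator hDt.compl)]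
    refine (add_le_add_left (hrun.lintegral_step_le ht (hW.indicator (hD t ht))
      (Φ := fun _ _ => 1) (fun _ => measurable_const)
      (Ψ := fun σ y => ENNReal.ofReal (Real.exp (Y σ y)))
      (fun σ => (Real.measurable_exp.comp (hY σ)).ennreal_ofReal) ?_) _).trans (le_of_eq ?_)
    · simp only [one_mul]
      exact (hrun.isPolicy ht).mono fun ω hω => hexp _ hω
    · rw [lintegral_indicator hDt, lintegral_indicator hDt.compl, lintegral_add_compl _ hDt]

/-- The deviation of a sum over the visits to a pair, whatever the number of visits is. -/
lemma IsRun.measure_deviation_le (hrun : IsRun M T δ m μ ℱ τ ρ q π) {h : Fin L} {x : S}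
    (hx : M.layer x = h) (a : A) (d : Traj S A L → (Fin L → ℝ) → ℝ) (hd : ∀ σ, Measurable (d σ))
    (hexp : ∀ c : ℝ, ∀ π : S → A → ℝ, IsPolicy π →
      ∑ σ : Traj S A L, ENNReal.ofReal (trajProb M.toLayeredSpace M.P π σ) *
      ∫⁻ y, ENNReal.ofReal (Real.exp (if σ.VisitsAt h x a then c * d σ y - c ^ 2 / 2 else 0))
        ∂M.rewardsLaw σ ≤ 1) {n : ℕ} (hn : 1 ≤ n) {u : ℝ} (hu : 0 ≤ u) :
    μ {ω | (∀ t < T, M.Valid (τ t ω)) ∧ ∃ t < T, numVisits (fun s => τ s ω) t x a = n ∧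
      √(2 * n * u) ≤ ∑ s ∈ Finset.range t,
        if (τ s ω).VisitsAt h x a then d (τ s ω) (ρ s ω) else 0} ≤
      ENNReal.ofReal (Real.exp (-u)) := by
  have hn' : (0 : ℝ) < n := by exact_mod_cast hn
  -- The minimizer of the Chernoff exponent for exactly `n` visits: at the threshold the compensated
  -- sum equals `2u - n c²/2 = u`.
  set c := √(2 * u / n) with hc
  have hc2 : c ^ 2 = 2 * u / n := Real.sq_sqrt (by positivity)
  have hcu : c * √(2 * n * u) = 2 * u := by
    rw [hc, ← Real.sqrt_mul (by positivity)]
    have : 2 * u / n * (2 * n * u) = (2 * u) ^ 2 := by field_simp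
    rw [this, Real.sqrt_sq (by linarith)]
  refine le_trans (measure_mono ?_) (hrun.measure_sum_ite_ge_le
    (fun s ω => numVisits (fun s => τ s ω) s x a < n) (fun s hs => ?_)
    (fun σ y => if σ.VisitsAt h x a then c * d σ y - c ^ 2 / 2 else 0) (fun σ => ?_) (hexp c) u)
  · rintro ω ⟨hval, t, ht, rfl, hdev⟩
    simp only [Set.mem_ofPred_eq]
    rw [sum_visits_truncate hval hx a ht.le (fun s => c * d (τ s ω) (ρ s ω) - c ^ 2 / 2)]
    have e : (∑ s ∈ Finset.range t, if (τ s ω).VisitsAt h x a then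
          c * d (τ s ω) (ρ s ω) - c ^ 2 / 2 else 0) =
        c * (∑ s ∈ Finset.range t, if (τ s ω).VisitsAt h x a then d (τ s ω) (ρ s ω) else 0) -
          (numVisits (fun s => τ s ω) t x a : ℝ) * (c ^ 2 / 2) := by
      rw [numVisits_eq (fun s hs => hval s (hs.trans ht)) hx]
      push_cast
      rw [Finset.mul_sum, Finset.sum_mul, ← Finset.sum_sub_distrib]
      refine Finset.sum_congr rfl fun s _ => ?_
      split_ifs <;> simp
    rw [e]
    have h1 := mul_le_mul_of_nonneg_left hdev (Real.sqrt_nonneg (2 * u /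
      (numVisits (fun s => τ s ω) t x a : ℝ)))
    rw [← hc, hcu] at h1
    have h2 : (numVisits (fun s => τ s ω) t x a : ℝ) * (c ^ 2 / 2) = u := by
      rw [hc2]; field_simp
    linarith
  · exact hrun.measurable_of_traj hs.le (fun τ => numVisits τ s x a) (fun τ₁ τ₂ h =>
      Finset.sum_congr rfl fun r hr => by rw [h r (Finset.mem_range.1 hr)]) measurableSet_Iio
  · split_ifs
    · exact ((hd σ).const_mul c).sub_const _
    · exact measurable_const

lemma lintegral_exp_reward_le (M : LayeredMDP S A L) {h : Fin L} {x : S} (a : A) (c : ℝ)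
    {π : S → A → ℝ} (hπ : IsPolicy π) :
    ∑ σ : Traj S A L, ENNReal.ofReal (trajProb M.toLayeredSpace M.P π σ) *
      ∫⁻ y, ENNReal.ofReal (Real.exp (if σ.VisitsAt h x a then
        c * (y h - M.r x a) - c ^ 2 / 2 else 0)) ∂M.rewardsLaw σ ≤ 1 := by
  have key : ∀ σ : Traj S A L, ∫⁻ y, ENNReal.ofReal (Real.exp (if σ.VisitsAt h x a then
        c * (y h - M.r x a) - c ^ 2 / 2 else 0)) ∂M.rewardsLaw σ ≤ 1 := by
    intro σ
    by_cases hv : σ.VisitsAt h x a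
    swap
    · simp [hv]
    simp only [if_pos hv]
    have hmp := measurePreserving_eval
      (fun h : Fin L => M.rewardLaw (σ.1 h.castSucc) (σ.2 h)) h
    simp only [hv.1, hv.2] at hmp
    have hmeas : Measurable fun z : ℝ =>
        ENNReal.ofReal (Real.exp (c * (z - M.r x a) - c ^ 2 / 2)) := by fun_prop
    have h1 := hmp.lintegral_comp hmeas
    refine (le_of_eq h1).trans ?_
    have h2 := lintegral_exp_sub_integral_le (M.rewardLaw_unitInterval x a) c
    simp_rw [sub_eq_add_neg _ (c ^ 2 / 2), Real.exp_add, ENNReal.ofReal_mul (Real.exp_pos _).le]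
    rw [lintegral_mul_const _ (by fun_prop)]
    refine (mul_le_mul_left h2 _).trans ?_
    -- Hoeffding on `[0,1]` gives `c²/8`, well below the compensator `c²/2`. The latter is chosen to
    -- serve the transitions as well, where `g` ranges over `[-1,1]` and it is attained exactly.
    rw [← ENNReal.ofReal_mul (Real.exp_pos _).le, ← Real.exp_add]
    refine ENNReal.ofReal_le_one.2 (Real.exp_le_one_iff.2 ?_)
    nlinarith [sq_nonneg c]
  refine (Finset.sum_le_sum fun σ _ => mul_le_of_le_one_right' (key σ)).trans (le_of_eq ?_)
  rw [← ENNReal.ofReal_sum_of_nonneg fun σ _ => M.trajProb_nonneg hπ σ]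
  rw [show ∑ σ, trajProb M.toLayeredSpace M.P π σ = 1 from sum_pathProb M.isTransition hπ le_rfl]
  exact ENNReal.ofReal_one

lemma lintegral_exp_transition_le (M : LayeredMDP S A L) {h : Fin L} {x : S}
    (hx : M.layer x = h) (a : A) {g : S → ℝ} (hg : ∀ y, g y ∈ Set.Icc (-1 : ℝ) 1) (c : ℝ)
    {π : S → A → ℝ} (hπ : IsPolicy π) :
    ∑ σ : Traj S A L, ENNReal.ofReal (trajProb M.toLayeredSpace M.P π σ) *
      ∫⁻ _y, ENNReal.ofReal (Real.exp (if σ.VisitsAt h x a then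
        c * (g (σ.1 h.succ) - ∑ x', M.P x a x' * g x') - c ^ 2 / 2 else 0))
          ∂M.rewardsLaw σ ≤ 1 := by
  simp only [lintegral_const, measure_univ, mul_one]
  simp_rw [← ENNReal.ofReal_mul (M.trajProb_nonneg hπ _)]
  rw [← ENNReal.ofReal_sum_of_nonneg fun σ _ =>
    mul_nonneg (M.trajProb_nonneg hπ σ) (Real.exp_pos _).le]
  refine ENNReal.ofReal_le_one.2 ?_
  refine (le_of_eq (sum_pathProb_mul_step M.isTransition hπ le_rfl h fun y b x' =>
    Real.exp (if y = x ∧ b = a then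
      c * (g x' - ∑ x', M.P x a x' * g x') - c ^ 2 / 2 else 0))).trans ?_
  rw [← sum_marg_mul_policy M.isTransition hπ h.2.le]
  refine Finset.sum_le_sum fun y _ => Finset.sum_le_sum fun b _ => ?_
  simp_rw [mul_assoc, ← Finset.mul_sum]
  refine mul_le_mul_of_nonneg_left ?_ (marg_nonneg M.isTransition hπ _ _ _)
  refine mul_le_of_le_one_right ((hπ y).1 b) ?_
  by_cases hv : y = x ∧ b = a
  · obtain ⟨rfl, rfl⟩ := hv
    simp only [and_self, if_true]
    have h1 := sum_mul_exp_sub_le (fun x' => M.isTransition.nonneg y b x')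
      (M.isTransition.sum_eq_one y b (by rw [hx]; exact h.2)) hg c
    simp_rw [sub_eq_add_neg _ (c ^ 2 / 2), Real.exp_add, ← mul_assoc, ← Finset.sum_mul]
    refine (mul_le_mul_of_nonneg_right h1 (Real.exp_pos _).le).trans ?_
    rw [← Real.exp_add, Real.exp_le_one_iff]
    apply le_of_eq
    ring
  · simp only [hv, if_false, Real.exp_zero, mul_one]
    exact sum_transition_le_one M.isTransition y b

end Tail

end UCRLLP

namespace UCRLLP

variable {S : Type u} {A : Type v} {L : ℕ}

/-! ### Cardinalities of layers -/

section Card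

variable [Fintype S] (G : LayeredSpace S L)

lemma LayeredSpace.layerCard_last : G.layerCard L = 1 := by
  rw [LayeredSpace.layerCard, Finset.card_eq_one]
  refine ⟨G.goal, ?_⟩
  ext x
  simp [G.layer_eq_last_iff]

omit [Fintype S] in
lemma LayeredSpace.start_ne_goal (hL : 1 ≤ L) : G.start ≠ G.goal := by
  intro h
  have h0 := (G.layer_eq_zero_iff G.start).2 rfl
  have h1 := (G.layer_eq_last_iff G.start).2 h
  omega

lemma LayeredSpace.two_le_card (G : LayeredSpace S L) (hL : 1 ≤ L) : 2 ≤ Fintype.card S :=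
  Fintype.one_lt_card_iff.2 ⟨_, _, G.start_ne_goal hL⟩

/-- The final layer is a singleton, so a next layer with two states is interior and both endpoints
lie outside it. -/
lemma LayeredSpace.four_le_card {h : ℕ} (hh : h < L) (h2 : 2 ≤ G.layerCard (h + 1)) :
    4 ≤ Fintype.card S := by
  classical
  have hne : h + 1 ≠ L := fun e => by
    rw [e, G.layerCard_last] at h2
    omega
  have hd : Disjoint {G.start, G.goal} (Finset.univ.filter fun x => G.layer x = h + 1) := by
    rw [Finset.disjoint_left]
    intro x hx hx'
    have hx' := (Finset.mem_filter.1 hx').2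
    simp only [Finset.mem_insert, Finset.mem_singleton] at hx
    rcases hx with hx | hx
    · rw [← G.layer_eq_zero_iff] at hx; omega
    · rw [← G.layer_eq_last_iff] at hx; omega
  have hc := Finset.card_le_univ (({G.start, G.goal} : Finset S) ∪
    (Finset.univ.filter fun x => G.layer x = h + 1))
  rw [Finset.card_union_of_disjoint hd, Finset.card_pair (G.start_ne_goal (by omega))] at hc
  have : (Finset.univ.filter fun x => G.layer x = h + 1).card = G.layerCard (h + 1) := rfl
  omega

lemma LayeredSpace.one_le_layerCard_succ [Nonempty A] {P : S → A → S → ℝ} (hP : IsTransition G P)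
    {x : S} (hx : G.layer x < L) : 1 ≤ G.layerCard (G.layer x + 1) := by
  obtain ⟨a⟩ := ‹Nonempty A›
  obtain ⟨x', -, hx'⟩ := Finset.exists_ne_zero_of_sum_ne_zero
    ((hP.sum_eq_one x a hx).trans_ne one_ne_zero)
  refine Finset.card_pos.2 ⟨x', Finset.mem_filter.2 ⟨Finset.mem_univ _, ?_⟩⟩
  by_contra h
  exact hx' (hP.layered x a x' h)

lemma LayeredSpace.le_card [Nonempty A] {P : S → A → S → ℝ} (hP : IsTransition G P) :
    L + 1 ≤ Fintype.card S := by
  have hex : ∀ h ≤ L, ∃ x, G.layer x = h := by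
    intro h
    induction h with
    | zero => exact fun _ => ⟨G.start, (G.layer_eq_zero_iff _).2 rfl⟩
    | succ h ih =>
      intro hh
      obtain ⟨x, hx⟩ := ih (by omega)
      obtain ⟨y, hy⟩ := Finset.card_pos.1 (G.one_le_layerCard_succ hP (x := x) (by omega))
      exact ⟨y, by rw [(Finset.mem_filter.1 hy).2, hx]⟩
  have : Nonempty S := ⟨G.start⟩
  choose! f hf using hex
  have hinj : Function.Injective fun h : Fin (L + 1) => f h := by
    intro i j hij
    have := congrArg G.layer hij
    simp only [hf _ (Nat.lt_succ_iff.1 i.2), hf _ (Nat.lt_succ_iff.1 j.2)] at this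
    exact Fin.ext this
  simpa using Fintype.card_le_of_injective _ hinj

lemma LayeredSpace.sum_layerCard_le (n : ℕ) :
    ∑ h ∈ Finset.range n, G.layerCard (h + 1) ≤ Fintype.card S := by
  classical
  simp only [LayeredSpace.layerCard]
  rw [← Finset.card_biUnion]
  · exact Finset.card_le_univ _
  · intro i _ j _ hij
    rw [Function.onFun, Finset.disjoint_left]
    intro x hx hx'
    have h1 := (Finset.mem_filter.1 hx).2
    have h2 := (Finset.mem_filter.1 hx').2
    omega

end Card

/-! ### The logarithmic term -/

section LogTerm

variable [Fintype S] [Fintype A] {T : ℕ} {δ : ℝ}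

lemma le_card_mul_div (hX : 1 ≤ Fintype.card S) [Nonempty A] (hT : 1 ≤ T) (hδ : 0 < δ)
    (hδ1 : δ < 1) : (Fintype.card S : ℝ) ≤ T * Fintype.card S * Fintype.card A / δ := by
  have hX' : (1 : ℝ) ≤ Fintype.card S := by exact_mod_cast hX
  have hA : (1 : ℝ) ≤ Fintype.card A := by exact_mod_cast Fintype.card_pos (α := A)
  have hT' : (1 : ℝ) ≤ T := by exact_mod_cast hT
  rw [le_div_iff₀ hδ]
  have h1 : (1 : ℝ) ≤ T * Fintype.card A := one_le_mul_of_one_le_of_one_le hT' hA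
  nlinarith

lemma exp_neg_logTerm (hX : 1 ≤ Fintype.card S) [Nonempty A] (hT : 1 ≤ T) (hδ : 0 < δ)
    (hδ1 : δ < 1) :
    Real.exp (-logTerm S A T δ) = δ / (T * Fintype.card S * Fintype.card A) := by
  have h := le_card_mul_div (S := S) (A := A) hX hT hδ hδ1
  have hX' : (1 : ℝ) ≤ Fintype.card S := by exact_mod_cast hX
  rw [logTerm, Real.exp_neg, Real.exp_log (by linarith), inv_div]

lemma exp_neg_logTerm_le (hX : 1 ≤ Fintype.card S) [Nonempty A] (hT : 1 ≤ T) (hδ : 0 < δ)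
    (hδ1 : δ < 1) : Real.exp (-logTerm S A T δ) ≤ 1 / Fintype.card S := by
  have h := le_card_mul_div (S := S) (A := A) hX hT hδ hδ1
  have hX' : (1 : ℝ) ≤ Fintype.card S := by exact_mod_cast hX
  rw [logTerm, Real.exp_neg, Real.exp_log (by linarith), inv_eq_one_div]
  exact one_div_le_one_div_of_le (by linarith) h

/-- The value `1/2` makes both confidence radii at least 1 at a pair with no visits and a nonempty
next layer, so unvisited pairs satisfy the confidence bounds trivially. -/
lemma half_le_logTerm (hX : 2 ≤ Fintype.card S) [Nonempty A] (hT : 1 ≤ T) (hδ : 0 < δ)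
    (hδ1 : δ < 1) : 1 / 2 ≤ logTerm S A T δ := by
  have h := le_card_mul_div (S := S) (A := A) (by omega) hT hδ hδ1
  have hX' : (2 : ℝ) ≤ Fintype.card S := by exact_mod_cast hX
  have h2 := Real.log_two_gt_d9
  have h3 := Real.log_le_log (by norm_num) (hX'.trans h)
  rw [logTerm]
  linarith

/-- There are `T · X · A` events, each of probability at most `δ / (T X A)`. The index `n` is a
visit count, so positive counts below `T` suffice for episodes before `T`. -/
lemma measure_iUnion_pair_le {Ω : Type w} [MeasurableSpace Ω] (μ : Measure Ω)
    (hX : 1 ≤ Fintype.card S) [Nonempty A] (hT : 1 ≤ T)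
    (hδ : 0 < δ) (hδ1 : δ < 1) (E : S → A → ℕ → Set Ω)
    (hE : ∀ x a n, μ (E x a n) ≤ ENNReal.ofReal (Real.exp (-logTerm S A T δ))) :
    μ (⋃ x, ⋃ a, ⋃ n ∈ Finset.range T, E x a n) ≤ ENNReal.ofReal δ := by
  have h1 : ∀ x a, μ (⋃ n ∈ Finset.range T, E x a n) ≤
      T * ENNReal.ofReal (Real.exp (-logTerm S A T δ)) := fun x a => by
    refine (measure_biUnion_finset_le _ _).trans ((Finset.sum_le_sum fun n _ => hE x a n).trans ?_)
    simp
  have h2 : ∀ x, μ (⋃ a, ⋃ n ∈ Finset.range T, E x a n) ≤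
      Fintype.card A * (T * ENNReal.ofReal (Real.exp (-logTerm S A T δ))) := fun x => by
    refine (measure_iUnion_fintype_le _ _).trans ((Finset.sum_le_sum fun a _ => h1 x a).trans ?_)
    simp
  refine (measure_iUnion_fintype_le _ _).trans ((Finset.sum_le_sum fun x _ => h2 x).trans ?_)
  rw [exp_neg_logTerm hX hT hδ hδ1]
  simp only [Finset.sum_const, Finset.card_univ, nsmul_eq_mul]
  simp_rw [← ENNReal.ofReal_natCast]
  rw [← ENNReal.ofReal_mul (by positivity), ← ENNReal.ofReal_mul (by positivity),
    ← ENNReal.ofReal_mul (by positivity)]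
  refine ENNReal.ofReal_le_ofReal (le_of_eq ?_)
  have hX' : (0 : ℝ) < Fintype.card S := by exact_mod_cast hX
  have hA : (0 : ℝ) < Fintype.card A := by exact_mod_cast Fintype.card_pos (α := A)
  have hT' : (0 : ℝ) < T := by exact_mod_cast hT
  field_simp

end LogTerm

/-! ### The confidence sets are valid with high probability -/

section Confidence

variable [Fintype S] [DecidableEq S] [Fintype A] [DecidableEq A] [Nonempty A]
  {M : LayeredMDP S A L} {T : ℕ} {δ : ℝ} {m : ℕ}
  {Ω : Type w} [mΩ : MeasurableSpace Ω] {μ : Measure Ω}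
  {ℱ : Filtration ℕ mΩ} {τ : ℕ → Ω → Traj S A L} {ρ : ℕ → Ω → Fin L → ℝ}
  {q : ℕ → Ω → S → A → S → ℝ} {π : ℕ → Ω → S → A → ℝ}

omit [DecidableEq S] [Fintype A] [DecidableEq A] [Nonempty A] in
lemma LayeredMDP.r_mem_Icc (M : LayeredMDP S A L) (x : S) (a : A) :
    M.r x a ∈ Set.Icc (0 : ℝ) 1 := by
  have h := M.rewardLaw_unitInterval x a
  constructor
  · exact integral_nonneg_of_ae (h.mono fun y hy => hy.1)
  · have := integral_mono_ae (Integrable.of_mem_Icc 0 1 aemeasurable_id h)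
      (integrable_const (1 : ℝ)) (h.mono fun y hy => hy.2)
    simpa [LayeredMDP.r] using this

/-- The sign `s = ±1` covers the upper and the lower deviation at once; in the exponential bound it
is absorbed into the parameter. -/
lemma IsRun.measure_reward_deviation_le [IsProbabilityMeasure μ]
    (hrun : IsRun M T δ m μ ℱ τ ρ q π) (hL : 1 ≤ L) (hT : 1 ≤ T)
    (hδ : 0 < δ) (hδ1 : δ < 1) {s : ℝ} (hs : s ^ 2 = 1) :
    μ {ω | (∀ t < T, M.Valid (τ t ω)) ∧ ∃ t < T, ∃ x a,
      radR T δ (fun s => τ s ω) t x a <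
        s * (empR (fun s => τ s ω) (fun s => ρ s ω) t x a - M.r x a)} ≤ ENNReal.ofReal δ := by
  have hX := M.two_le_card hL
  have hl := half_le_logTerm (A := A) hX hT hδ hδ1
  set E : S → A → ℕ → Set Ω := fun x a n => {ω | ∃ h : Fin L, M.layer x = h ∧ 1 ≤ n ∧
    (∀ t < T, M.Valid (τ t ω)) ∧ ∃ t < T, numVisits (fun s => τ s ω) t x a = n ∧
      √(2 * n * logTerm S A T δ) ≤ ∑ r ∈ Finset.range t,
        if (τ r ω).VisitsAt h x a then s * (ρ r ω h - M.r x a) else 0} with hEdef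
  have hE : ∀ x a n, μ (E x a n) ≤ ENNReal.ofReal (Real.exp (-logTerm S A T δ)) := by
    intro x a n
    by_cases hx : M.layer x < L
    swap
    · have : E x a n = ∅ := Set.eq_empty_iff_forall_notMem.2 fun ω ⟨h, hh, _⟩ => hx (hh ▸ h.2)
      simp [this]
    by_cases hn : 1 ≤ n
    swap
    · have : E x a n = ∅ := Set.eq_empty_iff_forall_notMem.2 fun ω ⟨h, hh, hn', _⟩ => hn hn'
      simp [this]
    refine (measure_mono ?_).trans (hrun.measure_deviation_le (h := ⟨_, hx⟩) (x := x) rfl a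
      (fun _ y => s * (y ⟨_, hx⟩ - M.r x a)) (fun _ => by fun_prop) (fun c π hπ => ?_) hn
      (by linarith : 0 ≤ logTerm S A T δ))
    · rintro ω ⟨h, hh, -, hω⟩
      obtain rfl : h = ⟨_, hx⟩ := Fin.ext hh.symm
      exact hω
    · have := lintegral_exp_reward_le M (h := ⟨_, hx⟩) (x := x) a (c * s) hπ
      simpa only [mul_pow, hs, mul_one, mul_assoc] using this
  refine (measure_mono ?_).trans (measure_iUnion_pair_le μ (by omega) hT hδ hδ1 E hE)
  rintro ω ⟨hval, t, ht, x, a, hdev⟩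
  have hr := M.r_mem_Icc x a
  rcases Nat.eq_zero_or_pos (numVisits (fun s => τ s ω) t x a) with h0 | hn
  · exfalso
    have h1 : (1 : ℝ) ≤ radR T δ (fun s => τ s ω) t x a := by
      rw [radR, h0]
      refine Real.one_le_sqrt.2 ?_
      simp
      linarith
    rw [empR, sumRewards_of_numVisits_eq_zero h0] at hdev
    have h2 : |s| = 1 := by
      rw [← Real.sqrt_sq_eq_abs, hs, Real.sqrt_one]
    have h3 := neg_abs_le s
    have h4 := le_abs_self s
    rw [h2] at h3 h4
    obtain ⟨h5, h6⟩ := hr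
    simp only [zero_div, zero_sub] at hdev
    nlinarith
  · have hx : M.layer x < L := by
      by_contra hx
      rw [numVisits_of_layer_eq (fun s hs => hval s (hs.trans ht)) hx] at hn
      exact lt_irrefl _ hn
    have hnt := numVisits_le (fun s hs => hval s (hs.trans ht)) x a
    simp only [Set.mem_iUnion]
    refine ⟨x, a, numVisits (fun s => τ s ω) t x a, Finset.mem_range.2 (by omega),
      ⟨_, hx⟩, rfl, hn, hval, t, ht, rfl, ?_⟩
    have e : (∑ r ∈ Finset.range t, if (τ r ω).VisitsAt ⟨_, hx⟩ x a then
          s * (ρ r ω ⟨_, hx⟩ - M.r x a) else 0) =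
        s * (sumRewards (fun s => τ s ω) (fun s => ρ s ω) t x a -
          numVisits (fun s => τ s ω) t x a * M.r x a) := by
      rw [numVisits_eq (h := ⟨_, hx⟩) (fun s hs => hval s (hs.trans ht)) rfl,
        sumRewards_eq (h := ⟨_, hx⟩) (fun s hs => hval s (hs.trans ht)) rfl]
      push_cast
      rw [Finset.sum_mul, ← Finset.sum_sub_distrib, Finset.mul_sum]
      refine Finset.sum_congr rfl fun s _ => ?_
      split_ifs <;> simp
    rw [e]
    rw [radR, empR] at hdev
    have hn1 : (1 : ℝ) ≤ numVisits (fun s => τ s ω) t x a := by exact_mod_cast hn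
    rw [max_eq_right hn1] at hdev
    generalize (numVisits (fun s => τ s ω) t x a : ℝ) = n at *
    have h1 : √(2 * n * logTerm S A T δ) = n * √(2 * logTerm S A T δ / n) := by
      rw [← Real.sqrt_sq (by linarith : 0 ≤ n), ← Real.sqrt_mul (by positivity),
        Real.sqrt_sq (by linarith)]
      congr 1
      field_simp
    rw [h1]
    refine (mul_le_mul_of_nonneg_left hdev.le (by linarith)).trans (le_of_eq ?_)
    field_simp

lemma IsRun.measure_transition_deviation_le [IsProbabilityMeasure μ]
    (hrun : IsRun M T δ m μ ℱ τ ρ q π) (hL : 1 ≤ L) (hT : 1 ≤ T)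
    (hδ : 0 < δ) (hδ1 : δ < 1) :
    μ {ω | (∀ t < T, M.Valid (τ t ω)) ∧ ∃ t < T,
      M.P ∉ confSet M.toLayeredSpace T δ (fun s => τ s ω) t} ≤ ENNReal.ofReal δ := by
  have hX := M.two_le_card hL
  have hl := half_le_logTerm (A := A) hX hT hδ hδ1
  -- An `ℓ¹` norm is the maximum over sign patterns of a linear functional. For each fixed pattern
  -- the deviation is a scalar sum over visits, and patterns on the next layer number `2 ^ K x`.
  set g : Finset S → S → ℝ := fun U y => if y ∈ U then 1 else -1 with hgdef
  have hg : ∀ U y, g U y ∈ Set.Icc (-1 : ℝ) 1 := by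
    intro U y
    simp only [hgdef]
    split_ifs <;> norm_num
  set K : S → ℕ := fun x => M.layerCard (M.layer x + 1) with hK
  set E : S → A → ℕ → Finset S → Set Ω := fun x a n U => {ω | ∃ h : Fin L, M.layer x = h ∧
    1 ≤ n ∧ 2 ≤ K x ∧
    (∀ t < T, M.Valid (τ t ω)) ∧ ∃ t < T, numVisits (fun s => τ s ω) t x a = n ∧
      √(2 * n * (K x * logTerm S A T δ)) ≤ ∑ r ∈ Finset.range t,
        if (τ r ω).VisitsAt h x a then
          g U ((τ r ω).1 h.succ) - ∑ x', M.P x a x' * g U x' else 0} with hEdef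
  have hE : ∀ x a n U, μ (E x a n U) ≤
      ENNReal.ofReal (Real.exp (-(K x * logTerm S A T δ))) := by
    intro x a n U
    by_cases hx : M.layer x < L
    swap
    · have : E x a n U = ∅ := Set.eq_empty_iff_forall_notMem.2 fun ω ⟨h, hh, _⟩ => hx (hh ▸ h.2)
      simp [this]
    by_cases hn : 1 ≤ n
    swap
    · have : E x a n U = ∅ := Set.eq_empty_iff_forall_notMem.2 fun ω ⟨h, hh, hn', _⟩ => hn hn'
      simp [this]
    refine (measure_mono ?_).trans (hrun.measure_deviation_le (h := ⟨_, hx⟩) (x := x) rfl a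
      (fun σ _ => g U (σ.1 (Fin.succ ⟨_, hx⟩)) - ∑ x', M.P x a x' * g U x')
      (fun _ => measurable_const)
      (fun c π hπ => lintegral_exp_transition_le M (h := ⟨_, hx⟩) (x := x) rfl a (hg U) c hπ) hn
      (mul_nonneg (Nat.cast_nonneg _) (by linarith) : 0 ≤ K x * logTerm S A T δ))
    rintro ω ⟨h, hh, -, -, hω⟩
    obtain rfl : h = ⟨_, hx⟩ := Fin.ext hh.symm
    exact hω
  have hE' : ∀ x a n, μ (⋃ U ∈ (Finset.univ.filter fun y => M.layer y = M.layer x + 1).powerset,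
      E x a n U) ≤ ENNReal.ofReal (Real.exp (-logTerm S A T δ)) := by
    intro x a n
    by_cases hx : M.layer x < L ∧ 2 ≤ K x
    swap
    · have : ∀ U, E x a n U = ∅ := fun U => Set.eq_empty_iff_forall_notMem.2
        fun ω ⟨h, hh, _, h2, _⟩ => hx ⟨hh ▸ h.2, h2⟩
      simp [this]
    have h4 : (4 : ℝ) ≤ Fintype.card S := by exact_mod_cast M.four_le_card hx.1 hx.2
    refine (measure_biUnion_finset_le _ _).trans
      ((Finset.sum_le_sum fun U _ => hE x a n U).trans ?_)
    rw [Finset.sum_const, Finset.card_powerset, nsmul_eq_mul, ← ENNReal.ofReal_natCast,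
      ← ENNReal.ofReal_mul (by positivity)]
    refine ENNReal.ofReal_le_ofReal ?_
    have hcard : (Finset.univ.filter fun y => M.layer y = M.layer x + 1).card = K x := rfl
    rw [hcard]
    -- With `z = exp(-logTerm) ≤ 1/4`, the union over the `2 ^ K` subsets costs `(2z)^K ≤ 4z² ≤ z`
    -- for `K ≥ 2`. It is therefore absorbed by the factor `K x` in the radius.
    obtain ⟨j, hj⟩ := Nat.exists_eq_add_of_le hx.2
    have hq : Real.exp (-logTerm S A T δ) ≤ 1 / 4 :=
      (exp_neg_logTerm_le (by omega) hT hδ hδ1).trans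
        (one_div_le_one_div_of_le (by norm_num) h4)
    have e : Real.exp (-(K x * logTerm S A T δ)) = Real.exp (-logTerm S A T δ) ^ K x := by
      rw [← Real.exp_nat_mul]
      ring_nf
    rw [e, hj]
    push_cast
    set z := Real.exp (-logTerm S A T δ)
    have hz : 0 < z := Real.exp_pos _
    have h5 : (2 * z) ^ j ≤ 1 := pow_le_one₀ (by linarith) (by linarith)
    calc (2 : ℝ) ^ (2 + j) * z ^ (2 + j) = 4 * z * z * (2 * z) ^ j := by
          rw [pow_add, pow_add, mul_pow]; ring
      _ ≤ 4 * z * z * 1 := mul_le_mul_of_nonneg_left h5 (by positivity)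
      _ ≤ z := by nlinarith
  refine (measure_mono ?_).trans (measure_iUnion_pair_le μ (by omega) hT hδ hδ1 _ hE')
  rintro ω ⟨hval, t, ht, hconf⟩
  have hval' : ∀ s < t, M.Valid (τ s ω) := fun s hs => hval s (hs.trans ht)
  have hP := M.isTransition
  simp only [confSet, Set.mem_ofPred_eq, not_and, not_forall, not_le] at hconf
  obtain ⟨x, a, hdev⟩ := hconf hP
  have hx : M.layer x < L := by
    by_contra hx
    have h0 := numVisits_of_layer_eq hval' hx a
    have h1 : ∀ x', M.P x a x' = 0 := fun x' => hP.layered x a x' (by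
      have := M.layer_le x'
      omega)
    simp only [empP, numTransitions_of_numVisits_eq_zero h0, h1] at hdev
    simp only [Nat.cast_zero, zero_div, sub_zero, abs_zero, Finset.sum_const_zero] at hdev
    exact absurd hdev (not_lt.2 (Real.sqrt_nonneg _))
  have hK1 : 1 ≤ K x := M.one_le_layerCard_succ hP hx
  rcases Nat.eq_zero_or_pos (numVisits (fun s => τ s ω) t x a) with h0 | hn
  · exfalso
    have h1 : (1 : ℝ) ≤ radP M.toLayeredSpace T δ (fun s => τ s ω) t x a := by
      rw [radP, h0]
      refine Real.one_le_sqrt.2 ?_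
      have : (1 : ℝ) ≤ M.layerCard (M.layer x + 1) := by exact_mod_cast hK1
      simp only [Nat.cast_zero, zero_le_one, sup_of_le_left, div_one]
      nlinarith
    simp only [empP, numTransitions_of_numVisits_eq_zero h0] at hdev
    simp only [Nat.cast_zero, zero_div, sub_zero, abs_of_nonneg (hP.nonneg _ _ _),
      hP.sum_eq_one x a hx] at hdev
    linarith
  set h : Fin L := ⟨_, hx⟩ with hh
  have hnt := numVisits_le hval' x a
  have hN := numVisits_eq (h := h) hval' rfl a
  have hNt := fun x' => numTransitions_eq (h := h) hval' rfl a x'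
  set n := numVisits (fun s => τ s ω) t x a with hndef
  have hn1 : (1 : ℝ) ≤ n := by exact_mod_cast hn
  -- The sign pattern attaining the `ℓ¹` norm. Outside the next layer both kernels vanish, so the
  -- value of `g` there is immaterial.
  set U := Finset.univ.filter fun y => M.layer y = M.layer x + 1 ∧
    M.P x a y ≤ empP (fun s => τ s ω) t x a y with hU
  have hoff : ∀ y, M.layer y ≠ M.layer x + 1 → empP (fun s => τ s ω) t x a y = 0 := by
    intro y hy
    rw [empP, hNt y, Finset.sum_eq_zero]
    · simp
    · intro s hs
      refine if_neg fun hv => hy ?_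
      have := hval' s (Finset.mem_range.1 hs) h.succ
      rw [hv.2] at this
      simpa [hh] using this
  have habs : ∀ y, |M.P x a y - empP (fun s => τ s ω) t x a y| =
      g U y * (empP (fun s => τ s ω) t x a y - M.P x a y) := by
    intro y
    by_cases hy : M.layer y = M.layer x + 1
    · by_cases hle : M.P x a y ≤ empP (fun s => τ s ω) t x a y
      · simp only [hgdef, hU, Finset.mem_filter, Finset.mem_univ, hy, hle, true_and, if_true,
          one_mul]
        rw [abs_sub_comm, abs_of_nonneg (by linarith)]
      · simp only [hgdef, hU, Finset.mem_filter, Finset.mem_univ, hle, and_false, if_false]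
        rw [abs_of_nonneg (by linarith)]
        ring
    · simp [hoff y hy, hP.layered x a y hy]
  have hsum : ∑ r ∈ Finset.range t, (if (τ r ω).VisitsAt h x a then
      g U ((τ r ω).1 h.succ) - ∑ x', M.P x a x' * g U x' else 0) =
      n * ∑ y, |M.P x a y - empP (fun s => τ s ω) t x a y| := by
    simp only [habs]
    simp only [empP, ← hndef, max_eq_right hn1, Finset.mul_sum]
    have e1 : ∀ y, (n : ℝ) * (g U y * (numTransitions (fun s => τ s ω) t x a y / n -
        M.P x a y)) = ∑ r ∈ Finset.range t, ((if (τ r ω).VisitsAt h x a ∧ (τ r ω).1 h.succ = y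
          then g U y else 0) - if (τ r ω).VisitsAt h x a then M.P x a y * g U y else 0) := by
      intro y
      have e2 : (n : ℝ) * (g U y * (numTransitions (fun s => τ s ω) t x a y / n -
        M.P x a y)) = numTransitions (fun s => τ s ω) t x a y * g U y -
          n * (M.P x a y * g U y) := by
        field_simp
      rw [e2, hNt y, hN]
      push_cast
      rw [Finset.sum_mul, Finset.sum_mul, ← Finset.sum_sub_distrib]
      refine Finset.sum_congr rfl fun r _ => ?_
      simp only [ite_mul, one_mul, zero_mul]
    simp only [e1]
    rw [Finset.sum_comm]
    refine Finset.sum_congr rfl fun r _ => ?_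
    rw [Finset.sum_sub_distrib]
    by_cases hv : (τ r ω).VisitsAt h x a
    · simp only [if_pos hv]
      rw [Finset.sum_eq_single ((τ r ω).1 h.succ)
        (fun y _ hy => if_neg fun h' => hy h'.2.symm) (by simp), if_pos ⟨hv, rfl⟩]
    · simp only [hv, false_and, if_false, Finset.sum_const_zero, sub_zero]
  have hrad : √(2 * n * (K x * logTerm S A T δ)) =
      n * radP M.toLayeredSpace T δ (fun s => τ s ω) t x a := by
    rw [radP, ← hndef, max_eq_right hn1]
    nth_rw 2 [← Real.sqrt_sq (by linarith : (0 : ℝ) ≤ n)]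
    rw [← Real.sqrt_mul (by positivity)]
    congr 1
    field_simp
    rfl
  have hgt : √(2 * n * (K x * logTerm S A T δ)) < ∑ r ∈ Finset.range t,
      (if (τ r ω).VisitsAt h x a then
        g U ((τ r ω).1 h.succ) - ∑ x', M.P x a x' * g U x' else 0) := by
    rw [hsum, hrad]
    exact mul_lt_mul_of_pos_left hdev (by linarith)
  -- With a single possible successor the transition is deterministic and the deviation is zero,
  -- which cannot exceed the radius.
  have hK2 : 2 ≤ K x := by
    by_contra hK2
    have hK3 : K x = 1 := by omega
    obtain ⟨z, hz⟩ := Finset.card_eq_one.1 hK3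
    have hz' : ∀ y, M.layer y = M.layer x + 1 ↔ y = z := fun y => by
      have := Finset.ext_iff.1 hz y
      simpa using this
    have h0 : ∀ y, y ≠ z → M.P x a y = 0 := fun y hy =>
      hP.layered x a y fun h => hy ((hz' y).1 h)
    have h1 : M.P x a z = 1 := by
      rw [← hP.sum_eq_one x a hx]
      exact (Finset.sum_eq_single z (fun y _ hy => h0 y hy) (by simp)).symm
    have h2 : ∑ x', M.P x a x' * g U x' = g U z := by
      rw [Finset.sum_eq_single z (fun y _ hy => by simp [h0 y hy]) (by simp), h1, one_mul]
    have h3 : (∑ r ∈ Finset.range t, (if (τ r ω).VisitsAt h x a then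
        g U ((τ r ω).1 h.succ) - ∑ x', M.P x a x' * g U x' else 0)) = 0 := by
      refine Finset.sum_eq_zero fun r hr => ?_
      have h4 : (τ r ω).1 h.succ = z :=
        (hz' _).1 (by simpa [hh] using hval' r (Finset.mem_range.1 hr) h.succ)
      rw [h2, h4]
      simp
    rw [h3] at hgt
    exact absurd hgt (not_lt.2 (Real.sqrt_nonneg _))
  simp only [Set.mem_iUnion]
  refine ⟨x, a, n, Finset.mem_range.2 (by omega), U, ?_, h, rfl, hn, hK2, hval, t, ht, rfl, hgt.le⟩
  rw [Finset.mem_powerset]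
  intro y hy
  rw [hU, Finset.mem_filter] at hy
  exact Finset.mem_filter.2 ⟨hy.1, hy.2.1⟩

end Confidence

end UCRLLP

namespace UCRLLP

variable {S : Type u} {A : Type v} {L : ℕ}

/-! ### Epochs -/

section Epoch

variable [DecidableEq S] [DecidableEq A]

lemma epochStart_le (m : ℕ) (τ : ℕ → Traj S A L) (t : ℕ) : epochStart m τ t ≤ t := by
  induction t with
  | zero => exact le_rfl
  | succ t ih =>
    rw [epochStart]
    split_ifs <;> omega

lemma numVisits_congr {τ₁ τ₂ : ℕ → Traj S A L} {t : ℕ} (h : ∀ s < t, τ₁ s = τ₂ s) :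
    numVisits τ₁ t = numVisits τ₂ t := by
  funext x a
  exact Finset.sum_congr rfl fun r hr => by rw [h r (Finset.mem_range.1 hr)]

lemma epochStart_congr (m : ℕ) {τ₁ τ₂ : ℕ → Traj S A L} {t : ℕ} (h : ∀ s < t, τ₁ s = τ₂ s) :
    epochStart m τ₁ t = epochStart m τ₂ t := by
  induction t with
  | zero => rfl
  | succ t ih =>
    have h1 := ih fun s hs => h s (by omega)
    have h2 := epochStart_le m τ₂ t
    rw [epochStart, epochStart, h1, numVisits_congr h,
      numVisits_congr (t := epochStart m τ₂ t) fun s hs => h s (by omega)]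

/-- Within an epoch the numbers of visits at most double. -/
lemma max_numVisits_le {m : ℕ} (hm : m ≤ 1) (τ : ℕ → Traj S A L) (t : ℕ) (x : S) (a : A) :
    max 1 (numVisits τ t x a) ≤ 2 * max 1 (numVisits τ (epochStart m τ t) x a) := by
  cases t with
  | zero => simp only [epochStart]; omega
  | succ t =>
    rw [epochStart]
    split_ifs with h
    · omega
    -- No pair passed the test. If `m = 0` this forces every pair to have been visited before the
    -- epoch; if `m = 1` an unvisited pair is still unvisited. Either way `max 1` of the count at
    -- most doubles.
    · push Not at h
      have := h x a
      omega

/-- The first episode visits some pair, whose count rises from 0 to at least 1, so the first epoch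
has length one for either value of `m`. -/
lemma epochStart_one {m : ℕ} (hm : m ≤ 1) (hL : 1 ≤ L) (τ : ℕ → Traj S A L) :
    epochStart m τ 1 = 1 := by
  rw [epochStart, if_pos]
  refine ⟨(τ 0).1 (Fin.castSucc ⟨0, hL⟩), (τ 0).2 ⟨0, hL⟩, ?_⟩
  have h0 : ∀ x a, numVisits τ (epochStart m τ 0) x a = 0 := fun x a => rfl
  have h1 : 1 ≤ numVisits τ (0 + 1) ((τ 0).1 (Fin.castSucc ⟨0, hL⟩)) ((τ 0).2 ⟨0, hL⟩) := by
    simp only [numVisits, zero_add, Finset.range_one, Finset.sum_singleton]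
    refine le_trans (le_of_eq ?_) (Finset.single_le_sum (fun _ _ => Nat.zero_le _)
      (Finset.mem_univ (⟨0, hL⟩ : Fin L)))
    simp
  rw [h0]
  omega

end Epoch

/-! ### The sum of the widths of the confidence intervals -/

lemma sum_div_sqrt_le (c N : ℕ → ℕ) (hc : ∀ t, N (t + 1) = N t + c t) (h0 : N 0 = 0) {T : ℕ}
    (h1 : ∀ t < T, c t ≤ 1) :
    ∑ t ∈ Finset.range T, (c t : ℝ) / √(max 1 (N t : ℝ)) ≤ 3 * √(N T) := by
  induction T with
  | zero => simp [h0]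
  | succ T ih =>
    rw [Finset.sum_range_succ]
    have ih := ih fun t ht => h1 t (by omega)
    have hcT := h1 T (by omega)
    rw [hc T]
    rcases Nat.le_one_iff_eq_zero_or_eq_one.1 hcT with h | h
    · simpa [h] using ih
    · rw [h]
      push_cast
      -- Telescoping. For `n ≥ 1` one has `√(n+1) ≤ 2√n`, hence `√(n+1) + √n ≤ 3√n`, the reciprocal
      -- of which gives the constant 3. The first visit costs 1.
      have key : (1 : ℝ) / √(max 1 (N T : ℝ)) ≤ 3 * √((N T : ℝ) + 1) - 3 * √(N T) := by
        rcases Nat.eq_zero_or_pos (N T) with hN | hN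
        · simp [hN]
        · have hN' : (1 : ℝ) ≤ N T := by exact_mod_cast hN
          rw [max_eq_right hN']
          generalize (N T : ℝ) = n at *
          have hs : 0 < √n := Real.sqrt_pos.2 (by linarith)
          have hs2 := Real.sq_sqrt (by linarith : 0 ≤ n)
          have hr2 := Real.sq_sqrt (by linarith : 0 ≤ n + 1)
          have hr : √(n + 1) ≤ 2 * √n := by
            rw [Real.sqrt_le_left (by positivity), mul_pow, hs2]
            linarith
          have hr0 := Real.sqrt_nonneg (n + 1)
          rw [div_le_iff₀ hs]
          have e : (√(n + 1) - √n) * (√(n + 1) + √n) = 1 := by nlinarith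
          have hd : 0 ≤ √(n + 1) - √n := sub_nonneg.2 (Real.sqrt_le_sqrt (by linarith))
          nlinarith
      linarith

section Widths

variable [Fintype S] [DecidableEq S] [Fintype A] [DecidableEq A]

/-- The clipped width of the confidence interval used in episode `t`. -/
def width (G : LayeredSpace S L) (T : ℕ) (δ : ℝ) (m : ℕ) (τ : ℕ → Traj S A L) (t : ℕ) (x : S)
    (a : A) : ℝ :=
  min 1 (radP G T δ τ (epochStart m τ t) x a)

variable {G : LayeredSpace S L} {T : ℕ} {δ : ℝ} {m : ℕ} {τ : ℕ → Traj S A L}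

lemma width_nonneg (t : ℕ) (x : S) (a : A) : 0 ≤ width G T δ m τ t x a :=
  le_min zero_le_one (Real.sqrt_nonneg _)

lemma width_le_one (t : ℕ) (x : S) (a : A) : width G T δ m τ t x a ≤ 1 := min_le_left _ _

lemma width_congr {τ₁ τ₂ : ℕ → Traj S A L} {t : ℕ} (h : ∀ s < t, τ₁ s = τ₂ s) (x : S) (a : A) :
    width G T δ m τ₁ t x a = width G T δ m τ₂ t x a := by
  have h2 := epochStart_le m τ₂ t
  rw [width, width, radP, radP, epochStart_congr m h,
    numVisits_congr (t := epochStart m τ₂ t) fun s hs => h s (by omega)]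

lemma width_le (hm : m ≤ 1) (hl : 0 ≤ logTerm S A T δ) (t : ℕ) (x : S) (a : A) :
    width G T δ m τ t x a ≤ 2 * √(logTerm S A T δ) * √(G.layerCard (G.layer x + 1)) *
      (1 / √(max 1 (numVisits τ t x a : ℝ))) := by
  refine (min_le_right _ _).trans ?_
  have e : 2 * √(logTerm S A T δ) * √(G.layerCard (G.layer x + 1)) =
      √(4 * logTerm S A T δ * G.layerCard (G.layer x + 1)) := by
    rw [Real.sqrt_mul (by positivity), Real.sqrt_mul (by norm_num),
      show (4 : ℝ) = 2 ^ 2 by norm_num, Real.sqrt_sq (by norm_num)]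
  rw [radP, mul_one_div, e, ← Real.sqrt_div' _ (by positivity)]
  refine Real.sqrt_le_sqrt ?_
  have h : max 1 (numVisits τ t x a : ℝ) ≤
      2 * max 1 (numVisits τ (epochStart m τ t) x a : ℝ) := by
    exact_mod_cast max_numVisits_le hm τ t x a
  have h1 : 0 < max 1 (numVisits τ t x a : ℝ) := by positivity
  have h2 : 0 < max 1 (numVisits τ (epochStart m τ t) x a : ℝ) := by positivity
  rw [div_le_div_iff₀ h2 h1]
  have h3 : 0 ≤ (2 * G.layerCard (G.layer x + 1) * logTerm S A T δ : ℝ) := by positivity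
  nlinarith

/-- An episode meets one state in each layer, so its visits weigh `∑ X_{h+1} ≤ X` in total. Keeping
the layer sizes in the radii saves a factor here. -/
lemma sum_layerCard_mul_numVisits_le (hτ : ∀ t < T, G.Valid (τ t)) :
    ∑ x, ∑ a, (G.layerCard (G.layer x + 1) : ℝ) * numVisits τ T x a ≤ T * Fintype.card S := by
  have e : ∑ x, ∑ a, G.layerCard (G.layer x + 1) * numVisits τ T x a =
      ∑ t ∈ Finset.range T, ∑ h : Fin L, G.layerCard (G.layer ((τ t).1 h.castSucc) + 1) := by
    simp only [numVisits, Finset.mul_sum]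
    simp only [Finset.sum_comm (s := Finset.univ (α := S)) (t := Finset.range T),
      Finset.sum_comm (s := Finset.univ (α := A)) (t := Finset.range T),
      Finset.sum_comm (s := Finset.univ (α := S)) (t := Finset.univ (α := Fin L)),
      Finset.sum_comm (s := Finset.univ (α := A)) (t := Finset.univ (α := Fin L))]
    refine Finset.sum_congr rfl fun t _ => Finset.sum_congr rfl fun h _ => ?_
    rw [Finset.sum_eq_single ((τ t).1 h.castSucc) (fun y _ hy => by simp [hy.symm]) (by simp),
      Finset.sum_eq_single ((τ t).2 h) (fun y _ hy => by simp [hy.symm]) (by simp)]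
    simp
  have h : ∑ x, ∑ a, G.layerCard (G.layer x + 1) * numVisits τ T x a ≤ T * Fintype.card S := by
    rw [e]
    refine (Finset.sum_le_sum (g := fun _ => Fintype.card S) fun t ht => ?_).trans (by simp)
    refine le_trans (le_of_eq ?_) (G.sum_layerCard_le L)
    rw [Finset.sum_range]
    refine Finset.sum_congr rfl fun h _ => ?_
    rw [hτ t (Finset.mem_range.1 ht)]
    rfl
  exact_mod_cast h

lemma sum_sqrt_le [Nonempty A] (hT : 1 ≤ T) (hτ : ∀ t < T, G.Valid (τ t)) :
    ∑ x, ∑ a, √(G.layerCard (G.layer x + 1)) * √(numVisits τ T x a) ≤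
      Fintype.card S * √(T * Fintype.card A) := by
  have hA : (0 : ℝ) < Fintype.card A := by exact_mod_cast Fintype.card_pos (α := A)
  have hT' : (0 : ℝ) < T := by exact_mod_cast hT
  -- Cauchy–Schwarz in the form of a termwise AM-GM: summed over all pairs, each of the two terms on
  -- the right contributes at most `T X A / 2`.
  have h1 : ∀ x a, √(T * Fintype.card A) *
      (√(G.layerCard (G.layer x + 1)) * √(numVisits τ T x a)) ≤
      (Fintype.card A * ((G.layerCard (G.layer x + 1) : ℝ) * numVisits τ T x a) + T) / 2 := by
    intro x a
    rw [mul_comm (T : ℝ), Real.sqrt_mul hA.le]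
    have e1 := Real.sq_sqrt hA.le
    have e2 := Real.sq_sqrt hT'.le
    have e3 := Real.sq_sqrt (Nat.cast_nonneg (α := ℝ) (G.layerCard (G.layer x + 1)))
    have e4 := Real.sq_sqrt (Nat.cast_nonneg (α := ℝ) (numVisits τ T x a))
    have h := two_mul_le_add_sq (√(Fintype.card A) * (√(G.layerCard (G.layer x + 1)) *
      √(numVisits τ T x a))) √T
    rw [mul_pow, mul_pow, e1, e2, e3, e4] at h
    linarith
  have h2 := Finset.sum_le_sum fun x (_ : x ∈ Finset.univ) =>
    Finset.sum_le_sum fun a (_ : a ∈ Finset.univ) => h1 x a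
  have h3 := sum_layerCard_mul_numVisits_le hτ
  simp only [← Finset.mul_sum, ← Finset.sum_div, Finset.sum_add_distrib, Finset.sum_const,
    Finset.card_univ, nsmul_eq_mul] at h2
  simp only [← Finset.mul_sum] at h3 ⊢
  have hs : 0 < √((T : ℝ) * Fintype.card A) := Real.sqrt_pos.2 (by positivity)
  have hs2 := Real.sq_sqrt (by positivity : 0 ≤ (T : ℝ) * Fintype.card A)
  refine le_of_mul_le_mul_left (h2.trans ?_) hs
  nlinarith

/-- The pigeonhole argument. -/
lemma sum_width_le [Nonempty A] (hm : m ≤ 1) (hl : 0 ≤ logTerm S A T δ) (hT : 1 ≤ T)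
    (hτ : ∀ t < T, G.Valid (τ t)) :
    ∑ t ∈ Finset.range T, ∑ h : Fin L, width G T δ m τ t ((τ t).1 h.castSucc) ((τ t).2 h) ≤
      6 * (Fintype.card S * √(T * Fintype.card A * logTerm S A T δ)) := by
  set c : S → A → ℕ → ℕ := fun x a t => ∑ h : Fin L, if (τ t).VisitsAt h x a then 1 else 0
    with hc
  have hc1 : ∀ x a, ∀ t < T, c x a t ≤ 1 := by
    intro x a t ht
    by_cases hx : G.layer x < L
    · simp only [hc]
      rw [(hτ t ht).sum_ite (h := ⟨_, hx⟩) (x := x) rfl (fun k => (τ t).VisitsAt k x a)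
        (fun _ hk => hk.1) fun _ => 1]
      split_ifs <;> omega
    · have h := numVisits_of_layer_eq (τ := fun _ => τ t) (t := 1) (fun _ _ => hτ t ht) hx a
      simp only [numVisits, Finset.range_one, Finset.sum_singleton] at h
      exact (le_of_eq h).trans zero_le_one
  have e : ∑ t ∈ Finset.range T, ∑ h : Fin L,
      width G T δ m τ t ((τ t).1 h.castSucc) ((τ t).2 h) =
      ∑ x, ∑ a, ∑ t ∈ Finset.range T, (c x a t : ℝ) * width G T δ m τ t x a := by
    simp only [hc, Nat.cast_sum, Finset.sum_mul]
    simp only [Finset.sum_comm (s := Finset.univ (α := S)) (t := Finset.range T),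
      Finset.sum_comm (s := Finset.univ (α := A)) (t := Finset.range T),
      Finset.sum_comm (s := Finset.univ (α := S)) (t := Finset.univ (α := Fin L)),
      Finset.sum_comm (s := Finset.univ (α := A)) (t := Finset.univ (α := Fin L))]
    refine Finset.sum_congr rfl fun t _ => Finset.sum_congr rfl fun h _ => ?_
    rw [Finset.sum_eq_single ((τ t).1 h.castSucc) (fun y _ hy => Finset.sum_eq_zero fun a _ => by
        rw [if_neg fun hv => hy hv.1.symm, Nat.cast_zero, zero_mul]) (by simp),
      Finset.sum_eq_single ((τ t).2 h) (fun y _ hy => by simp [hy.symm]) (by simp)]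
    simp
  rw [e]
  have h1 : ∀ x a, ∑ t ∈ Finset.range T, (c x a t : ℝ) * width G T δ m τ t x a ≤
      6 * √(logTerm S A T δ) * (√(G.layerCard (G.layer x + 1)) * √(numVisits τ T x a)) := by
    intro x a
    have h2 := sum_div_sqrt_le (c x a) (fun t => numVisits τ t x a)
      (fun t => Finset.sum_range_succ _ _) rfl (hc1 x a)
    have h3 : 0 ≤ 2 * √(logTerm S A T δ) * √(G.layerCard (G.layer x + 1)) := by positivity
    calc _ ≤ ∑ t ∈ Finset.range T, 2 * √(logTerm S A T δ) * √(G.layerCard (G.layer x + 1)) *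
          ((c x a t : ℝ) / √(max 1 (numVisits τ t x a : ℝ))) := by
          refine Finset.sum_le_sum fun t _ => ?_
          refine (mul_le_mul_of_nonneg_left (width_le hm hl t x a) (Nat.cast_nonneg _)).trans
            (le_of_eq ?_)
          ring
      _ = 2 * √(logTerm S A T δ) * √(G.layerCard (G.layer x + 1)) *
          ∑ t ∈ Finset.range T, ((c x a t : ℝ) / √(max 1 (numVisits τ t x a : ℝ))) := by
          rw [Finset.mul_sum]
      _ ≤ 2 * √(logTerm S A T δ) * √(G.layerCard (G.layer x + 1)) *
          (3 * √(numVisits τ T x a)) := mul_le_mul_of_nonneg_left h2 h3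
      _ = _ := by ring
  refine (Finset.sum_le_sum fun x _ => Finset.sum_le_sum fun a _ => h1 x a).trans ?_
  simp_rw [← Finset.mul_sum _ _ (6 * √(logTerm S A T δ))]
  have h4 := mul_le_mul_of_nonneg_left (sum_sqrt_le hT hτ)
    (by positivity : 0 ≤ 6 * √(logTerm S A T δ))
  refine h4.trans (le_of_eq ?_)
  rw [Real.sqrt_mul (by positivity) (logTerm S A T δ)]
  ring

end Widths

/-! ### The regret bound -/

section Regret

variable [Fintype S] [DecidableEq S] [Fintype A] [DecidableEq A]
  {M : LayeredMDP S A L} {T : ℕ} {δ : ℝ} {m : ℕ}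
  {Ω : Type w} [mΩ : MeasurableSpace Ω] {μ : Measure Ω}
  {ℱ : Filtration ℕ mΩ} {τ : ℕ → Ω → Traj S A L} {ρ : ℕ → Ω → Fin L → ℝ}
  {q : ℕ → Ω → S → A → S → ℝ} {π : ℕ → Ω → S → A → ℝ}

omit [DecidableEq A] in
lemma payoff_const {G : LayeredSpace S L} {P : S → A → S → ℝ} {π : S → A → ℝ}
    (hP : IsTransition G P) (hπ : IsPolicy π) (c : ℝ) :
    payoff G P π (fun _ _ => c) = L * c := by
  rw [← sum_trajProb_mul_eq_payoff hP hπ]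
  simp only [Finset.sum_const, Finset.card_univ, Fintype.card_fin, nsmul_eq_mul,
    ← Finset.sum_mul]
  rw [show ∑ σ, trajProb G P π σ = 1 from sum_pathProb hP hπ le_rfl, one_mul]

lemma IsRun.ae_isLPSolution (hrun : IsRun M T δ m μ ℱ τ ρ q π) (hm : m ≤ 1) (hL : 1 ≤ L) :
    ∀ᵐ ω ∂μ, ∀ t, 1 ≤ t → t < T →
      IsLPSolution M.toLayeredSpace T δ (fun s => τ s ω) (fun s => ρ s ω)
        (epochStart m (fun s => τ s ω) t) (q t ω) := by
  have h : ∀ᵐ ω ∂μ, ∀ t, t + 1 < T →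
      (epochStart m (fun s => τ s ω) (t + 1) = t + 1 →
        IsLPSolution M.toLayeredSpace T δ (fun s => τ s ω) (fun s => ρ s ω) (t + 1)
          (q (t + 1) ω)) ∧
      (epochStart m (fun s => τ s ω) (t + 1) ≠ t + 1 → q (t + 1) ω = q t ω) := by
    refine ae_all_iff.2 fun t => ?_
    by_cases ht : t + 1 < T
    · filter_upwards [hrun.new_epoch t ht, hrun.same_epoch t ht] with ω h1 h2 _
      exact ⟨h1, fun h => (h2 h).1⟩
    · exact Filter.Eventually.of_forall fun _ h => absurd h ht
  filter_upwards [h] with ω hω t ht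
  -- The induction starts at episode 1, where a new epoch always begins; only episode 0 uses
  -- `initOcc`.
  induction t, ht using Nat.le_induction with
  | base =>
    intro hT
    have h1 := epochStart_one hm hL fun s => τ s ω
    rw [h1]
    exact (hω 0 hT).1 h1
  | succ t ht ih =>
    intro hT
    by_cases he : epochStart m (fun s => τ s ω) (t + 1) = t + 1
    · rw [he]
      exact (hω t hT).1 he
    · rw [(hω t hT).2 he]
      have e : epochStart m (fun s => τ s ω) (t + 1) = epochStart m (fun s => τ s ω) t := by
        rw [epochStart] at he ⊢
        split_ifs at he ⊢
        · exact absurd rfl he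
        · rfl
      rw [e]
      exact ih (by omega)

/-- The sum of the clipped widths along a trajectory. -/
def pathWidth (G : LayeredSpace S L) (T : ℕ) (δ : ℝ) (m : ℕ) (τ : ℕ → Traj S A L) (t : ℕ)
    (σ : Traj S A L) : ℝ :=
  ∑ h : Fin L, width G T δ m τ t (σ.1 h.castSucc) (σ.2 h)

lemma IsRun.measure_width_deviation_le [Nonempty A] [IsProbabilityMeasure μ]
    (hrun : IsRun M T δ m μ ℱ τ ρ q π)
    (hL : 1 ≤ L) (hT : 1 ≤ T) (hδ : 0 < δ) (hδ1 : δ < 1) :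
    μ {ω | 2 * L * √(T * logTerm S A T δ) ≤ ∑ t ∈ Finset.range T,
      (∑ σ, trajProb M.toLayeredSpace M.P (π t ω) σ *
          pathWidth M.toLayeredSpace T δ m (fun s => τ s ω) t σ -
        pathWidth M.toLayeredSpace T δ m (fun s => τ s ω) t (τ t ω))} ≤ ENNReal.ofReal δ := by
  have hX := M.two_le_card hL
  have hl := half_le_logTerm (A := A) hX hT hδ hδ1
  set F : ℕ → Ω → Traj S A L → ℝ := fun t ω σ =>
    pathWidth M.toLayeredSpace T δ m (fun s => τ s ω) t σ with hF
  set EF : ℕ → Ω → ℝ := fun t ω => ∑ σ, trajProb M.toLayeredSpace M.P (π t ω) σ * F t ω σ with hEF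
  have hL' : (1 : ℝ) ≤ L := by exact_mod_cast hL
  have hT' : (1 : ℝ) ≤ T := by exact_mod_cast hT
  -- The sum of widths along a trajectory lies in `[0, L]`, so an episode costs `c² L² / 8`. This
  -- `c` turns the threshold into `2 logTerm`, against a total compensator of `logTerm / 8`.
  set c : ℝ := √(logTerm S A T δ / T) / L with hcdef
  have hFmeas : ∀ t < T, ∀ σ, Measurable[ℱ t] fun ω => F t ω σ := fun t ht σ =>
    hrun.measurable_of_traj ht.le (fun τ => pathWidth M.toLayeredSpace T δ m τ t σ)
      fun τ₁ τ₂ h => Finset.sum_congr rfl fun k _ => width_congr h _ _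
  have hEFmeas : ∀ t < T, Measurable[ℱ t] (EF t) := fun t ht =>
    Finset.measurable_sum _ fun σ _ => (hrun.measurable_trajProb ht σ).mul (hFmeas t ht σ)
  set Z : ℕ → Ω → Traj S A L → ℝ := fun t ω σ =>
    c * (EF t ω - F t ω σ) - c ^ 2 * L ^ 2 / 8 with hZ
  have hZmeas : ∀ t < T, ∀ σ, Measurable[ℱ t] fun ω => Z t ω σ := fun t ht σ =>
    (((hEFmeas t ht).sub (hFmeas t ht σ)).const_mul c).sub_const _
  have key := measure_sum_ge_le_of_supermartingale (μ := μ) (ℱ := ℱ) (T := T)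
    (fun t ω => Z t ω (τ t ω)) (fun t ht => ?_) (fun t ht W hW => ?_) (logTerm S A T δ)
  · refine (measure_mono ?_).trans (key.trans ?_)
    · intro ω hω
      simp only [Set.mem_ofPred_eq] at hω ⊢
      have h1 : ∑ t ∈ Finset.range T, Z t ω (τ t ω) =
          c * (∑ t ∈ Finset.range T, (EF t ω - F t ω (τ t ω))) - T * (c ^ 2 * L ^ 2 / 8) := by
        simp only [hZ, Finset.sum_sub_distrib, Finset.mul_sum, mul_sub, Finset.sum_const,
          Finset.card_range, nsmul_eq_mul]
      rw [h1]
      have hc0 : 0 ≤ c := by positivity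
      have h2 := mul_le_mul_of_nonneg_left hω hc0
      have h3 : c * (2 * L * √(T * logTerm S A T δ)) = 2 * logTerm S A T δ := by
        have : √(logTerm S A T δ / T) * √(T * logTerm S A T δ) = logTerm S A T δ := by
          rw [← Real.sqrt_mul (by positivity)]
          have : logTerm S A T δ / T * (T * logTerm S A T δ) = logTerm S A T δ ^ 2 := by
            field_simp
          rw [this, Real.sqrt_sq (by linarith)]
        calc c * (2 * L * √(T * logTerm S A T δ)) =
            2 * (√(logTerm S A T δ / T) * √(T * logTerm S A T δ)) := by
              rw [hcdef]; field_simp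
          _ = _ := by rw [this]
      have h4 : T * (c ^ 2 * L ^ 2 / 8) = logTerm S A T δ / 8 := by
        rw [hcdef, div_pow, Real.sq_sqrt (by positivity)]
        field_simp
      rw [h3] at h2
      rw [h4]
      linarith
    · rw [exp_neg_logTerm (by omega) hT hδ hδ1]
      refine ENNReal.ofReal_le_ofReal (div_le_self hδ.le ?_)
      have hX' : (1 : ℝ) ≤ Fintype.card S := by exact_mod_cast (by omega : 1 ≤ Fintype.card S)
      have hA : (1 : ℝ) ≤ Fintype.card A := by exact_mod_cast Fintype.card_pos (α := A)
      exact one_le_mul_of_one_le_of_one_le (one_le_mul_of_one_le_of_one_le hT' hX') hA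
  · have e : (fun ω => Z t ω (τ t ω)) = fun ω =>
        ∑ σ, {ω | τ t ω = σ}.indicator (fun ω => Z t ω σ) ω := by
      funext ω
      rw [Finset.sum_eq_single (τ t ω) (fun σ _ hσ => by simp [Ne.symm hσ]) (by simp)]
      simp
    rw [e]
    exact Finset.measurable_sum _ fun σ _ =>
      ((hZmeas t ht σ).mono (ℱ.mono (Nat.le_succ t)) le_rfl).indicator
        (hrun.measurable_traj t ht σ)
  · have h := hrun.lintegral_step_le ht hW
      (Φ := fun ω σ => ENNReal.ofReal (Real.exp (Z t ω σ)))
      (fun σ => (Real.measurable_exp.comp (hZmeas t ht σ)).ennreal_ofReal)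
      (Ψ := fun _ _ => 1) (fun _ => measurable_const) ?_
    · simpa only [mul_one] using h
    · refine (hrun.isPolicy ht).mono fun ω hω => ?_
      simp only [lintegral_const, measure_univ, mul_one]
      simp_rw [← ENNReal.ofReal_mul (M.trajProb_nonneg hω _)]
      rw [← ENNReal.ofReal_sum_of_nonneg fun σ _ =>
        mul_nonneg (M.trajProb_nonneg hω σ) (Real.exp_pos _).le]
      refine ENNReal.ofReal_le_one.2 ?_
      have hb : ∀ σ, F t ω σ ∈ Set.Icc (0 : ℝ) L := fun σ =>
        ⟨Finset.sum_nonneg fun _ _ => width_nonneg _ _ _,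
          (Finset.sum_le_sum fun _ _ => width_le_one _ _ _).trans (by simp)⟩
      have h1 := sum_mul_exp_sub_le (M.trajProb_nonneg hω)
        (sum_pathProb M.isTransition hω le_rfl) hb (-c)
      have e : ∀ σ, Z t ω σ = -c * (F t ω σ - EF t ω) + -(c ^ 2 * L ^ 2 / 8) := fun σ => by
        simp only [hZ]; ring
      simp_rw [e, Real.exp_add, ← mul_assoc, ← Finset.sum_mul]
      refine (mul_le_mul_of_nonneg_right h1 (Real.exp_pos _).le).trans (le_of_eq ?_)
      rw [← Real.exp_add, Real.exp_eq_one_iff]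
      ring

omit [DecidableEq A] in
lemma LayeredMDP.V_eq_payoff (M : LayeredMDP S A L) {π : S → A → ℝ} (hπ : IsPolicy π) :
    M.V π = payoff M.toLayeredSpace M.P π M.r :=
  sum_trajProb_mul_eq_payoff M.isTransition hπ M.r

/-- The regret bound on the event that all the confidence sets are valid. -/
lemma regret_le_of_good [Nonempty A]
    {τ : ℕ → Traj S A L} {ρ : ℕ → Fin L → ℝ}
    {q : ℕ → S → A → S → ℝ} {π : ℕ → S → A → ℝ} (hm : m ≤ 1) (hL : 1 ≤ L) (hT : 1 ≤ T)
    (hδ : 0 < δ) (hδ1 : δ < 1) {πs : S → A → ℝ} (hπs : IsPolicy πs)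
    (hval : ∀ t < T, M.Valid (τ t)) (hind : ∀ t < T, Induces (q t) (π t))
    (hq : ∀ t, 1 ≤ t → t < T →
      IsLPSolution M.toLayeredSpace T δ τ ρ (epochStart m τ t) (q t))
    (hconf : ∀ t < T, M.P ∈ confSet M.toLayeredSpace T δ τ t)
    (hrew : ∀ t < T, ∀ x a, |empR τ ρ t x a - M.r x a| ≤ radR T δ τ t x a)
    (hdev : ∑ t ∈ Finset.range T, (∑ σ, trajProb M.toLayeredSpace M.P (π t) σ *
        pathWidth M.toLayeredSpace T δ m τ t σ - pathWidth M.toLayeredSpace T δ m τ t (τ t)) ≤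
      2 * L * √(T * logTerm S A T δ)) :
    M.regret T πs π ≤
      33 * (L * Fintype.card S * √(T * Fintype.card A * logTerm S A T δ)) := by
  have hX := M.two_le_card hL
  have hl := half_le_logTerm (A := A) hX hT hδ hδ1
  have hP := M.isTransition
  set Wd : ℕ → ℝ := fun t =>
    payoff M.toLayeredSpace M.P (π t) (width M.toLayeredSpace T δ m τ t) with hW
  have hWd : ∀ t < T, ∑ σ, trajProb M.toLayeredSpace M.P (π t) σ *
      pathWidth M.toLayeredSpace T δ m τ t σ = Wd t := fun t ht =>
    sum_trajProb_mul_eq_payoff hP (hind t ht).1 _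
  have hWd0 : ∀ t < T, 0 ≤ Wd t := fun t ht =>
    payoff_nonneg hP (hind t ht).1 fun x a => width_nonneg t x a
  have hstep : ∀ t, 1 ≤ t → t < T → M.V πs - M.V (π t) ≤ 4 * L * Wd t := by
    intro t ht1 ht
    have he : epochStart m τ t < T := (epochStart_le m τ t).trans_lt ht
    rw [M.V_eq_payoff hπs, M.V_eq_payoff (hind t ht).1]
    have habs := fun x a => abs_le.1 (hrew _ he x a)
    refine payoff_sub_le_of_optimistic hL (b := radR T δ τ (epochStart m τ t))
      (rhat := ucbR T δ τ ρ (epochStart m τ t)) (Ps := confSet M.toLayeredSpace T δ τ _)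
      (fun P' hP' => hP') (hconf _ he) (fun x a => (M.r_mem_Icc x a).1) (fun x a => ?_)
      (fun x a => min_le_left _ _) (fun x a => ?_) (fun x hx a => ?_) (hq t ht1 ht).1
      (hq t ht1 ht).2 (hind t ht) hπs
    · exact le_min (M.r_mem_Icc x a).2 (by linarith [(habs x a).1])
    · exact (min_le_right _ _).trans (by linarith [(habs x a).2])
    · have hK : (1 : ℝ) ≤ M.layerCard (M.layer x + 1) := by
        exact_mod_cast M.one_le_layerCard_succ hP hx
      refine Real.sqrt_le_sqrt (div_le_div_of_nonneg_right ?_ (by positivity))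
      nlinarith
  -- Episode 0 is not optimistic and is charged the maximal value `L`. The nonnegative extra term
  -- lets all episodes be summed uniformly.
  have hfirst : M.V πs - M.V (π 0) ≤ L + 4 * L * Wd 0 := by
    rw [M.V_eq_payoff hπs, M.V_eq_payoff (hind 0 hT).1]
    have h1 := payoff_mono hP hπs (f := M.r) (g := fun _ _ => 1)
      fun x _ a => (M.r_mem_Icc x a).2
    rw [payoff_const hP hπs] at h1
    have h2 := payoff_nonneg hP (hind 0 hT).1 fun x a => (M.r_mem_Icc x a).1
    have h3 := hWd0 0 hT
    have h4 : 0 ≤ 4 * L * Wd 0 := by positivity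
    linarith
  have hsum : M.regret T πs π ≤ L + 4 * L * ∑ t ∈ Finset.range T, Wd t := by
    have e : M.regret T πs π = ∑ t ∈ Finset.range T, (M.V πs - M.V (π t)) := by
      simp [LayeredMDP.regret, Finset.sum_sub_distrib]
    rw [e]
    obtain ⟨k, rfl⟩ := Nat.exists_eq_add_of_le' hT
    rw [Finset.sum_range_succ', Finset.sum_range_succ', mul_add]
    have h1 : ∑ t ∈ Finset.range k, (M.V πs - M.V (π (t + 1))) ≤
        4 * L * ∑ t ∈ Finset.range k, Wd (t + 1) := by
      rw [Finset.mul_sum]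
      exact Finset.sum_le_sum fun t ht =>
        hstep (t + 1) (by omega) (by have := Finset.mem_range.1 ht; omega)
    linarith
  rw [Finset.sum_sub_distrib,
    Finset.sum_congr rfl fun t ht => hWd t (Finset.mem_range.1 ht)] at hdev
  have hpig := sum_width_le (G := M.toLayeredSpace) (δ := δ) hm (by linarith) hT hval
  have hpig' : ∑ t ∈ Finset.range T, pathWidth M.toLayeredSpace T δ m τ t (τ t) ≤
      6 * (Fintype.card S * √(T * Fintype.card A * logTerm S A T δ)) := hpig
  have hLX : (L : ℝ) ≤ Fintype.card S := by
    have := M.le_card (A := A) hP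
    exact_mod_cast (by omega : L ≤ Fintype.card S)
  have hX' : (2 : ℝ) ≤ Fintype.card S := by exact_mod_cast hX
  have hA : (1 : ℝ) ≤ Fintype.card A := by exact_mod_cast Fintype.card_pos (α := A)
  have hT' : (1 : ℝ) ≤ T := by exact_mod_cast hT
  set R := √(T * Fintype.card A * logTerm S A T δ) with hR
  have hTA : (1 : ℝ) ≤ T * Fintype.card A := one_le_mul_of_one_le_of_one_le hT' hA
  have h1 : √(T * logTerm S A T δ) ≤ R := by
    refine Real.sqrt_le_sqrt ?_
    have := mul_le_mul_of_nonneg_left hA (by positivity : 0 ≤ T * logTerm S A T δ)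
    linarith
  have h2 : 1 / 2 ≤ R := by
    refine Real.le_sqrt_of_sq_le ?_
    nlinarith
  have hXR : 1 ≤ Fintype.card S * R := by nlinarith
  have h3 : L * √(T * logTerm S A T δ) ≤ Fintype.card S * R :=
    mul_le_mul hLX h1 (Real.sqrt_nonneg _) (by positivity)
  -- Six from the pigeonhole sum and two from the martingale, whose factor `L` is absorbed by `L ≤
  -- X`.
  have h4 : ∑ t ∈ Finset.range T, Wd t ≤ 8 * (Fintype.card S * R) := by linarith
  have hL0 : (0 : ℝ) ≤ L := Nat.cast_nonneg _
  have h5 := mul_le_mul_of_nonneg_left h4 (by positivity : (0 : ℝ) ≤ 4 * L)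
  have h6 := mul_le_mul_of_nonneg_left hXR hL0
  calc M.regret T πs π ≤ L + 4 * L * ∑ t ∈ Finset.range T, Wd t := hsum
    _ ≤ L * (Fintype.card S * R) + 4 * L * (8 * (Fintype.card S * R)) := by linarith
    _ = 33 * (L * Fintype.card S * R) := by ring

/-- The regret bound with high probability. -/
lemma IsRun.regret_bound [Nonempty A] [IsProbabilityMeasure μ]
    (hrun : IsRun M T δ m μ ℱ τ ρ q π)
    (hm : m ≤ 1) (hL : 1 ≤ L) (hT : 1 ≤ T) (hδ : 0 < δ) (hδ1 : δ < 1) {πs : S → A → ℝ}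
    (hπs : IsPolicy πs) :
    1 - 4 * δ ≤ μ.real {ω | M.regret T πs (fun t => π t ω) ≤
      33 * (L * Fintype.card S * √(T * Fintype.card A * logTerm S A T δ))} := by
  have hind : ∀ᵐ ω ∂μ, ∀ t < T, Induces (q t ω) (π t ω) := by
    refine ae_all_iff.2 fun t => ?_
    by_cases ht : t < T
    · exact (hrun.induces t ht).mono fun _ h _ => h
    · exact Filter.Eventually.of_forall fun _ h => absurd h ht
  have hae := (hrun.ae_valid.and hind).and (hrun.ae_isLPSolution hm hL)
  have hb : ∀ {B : Set Ω}, μ B ≤ ENNReal.ofReal δ → μ.real B ≤ δ := fun h =>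
    ENNReal.toReal_le_of_le_ofReal hδ.le h
  have h1 := hb (hrun.measure_transition_deviation_le hL hT hδ hδ1)
  have h2 := hb (hrun.measure_reward_deviation_le hL hT hδ hδ1 (s := 1) (by norm_num))
  have h3 := hb (hrun.measure_reward_deviation_le hL hT hδ hδ1 (s := -1) (by norm_num))
  have h4 := hb (hrun.measure_width_deviation_le hL hT hδ hδ1)
  set B1 := {ω | (∀ t < T, M.Valid (τ t ω)) ∧ ∃ t < T,
    M.P ∉ confSet M.toLayeredSpace T δ (fun s => τ s ω) t} with hB1
  set B2 := {ω | (∀ t < T, M.Valid (τ t ω)) ∧ ∃ t < T, ∃ x a,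
    radR T δ (fun s => τ s ω) t x a <
      1 * (empR (fun s => τ s ω) (fun s => ρ s ω) t x a - M.r x a)} with hB2
  set B3 := {ω | (∀ t < T, M.Valid (τ t ω)) ∧ ∃ t < T, ∃ x a,
    radR T δ (fun s => τ s ω) t x a <
      -1 * (empR (fun s => τ s ω) (fun s => ρ s ω) t x a - M.r x a)} with hB3
  set B4 := {ω | 2 * L * √(T * logTerm S A T δ) ≤ ∑ t ∈ Finset.range T,
      (∑ σ, trajProb M.toLayeredSpace M.P (π t ω) σ *
          pathWidth M.toLayeredSpace T δ m (fun s => τ s ω) t σ -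
        pathWidth M.toLayeredSpace T δ m (fun s => τ s ω) t (τ t ω))} with hB4
  set N := {ω | ¬ (((∀ t < T, M.Valid (τ t ω)) ∧ ∀ t < T, Induces (q t ω) (π t ω)) ∧
    ∀ t, 1 ≤ t → t < T → IsLPSolution M.toLayeredSpace T δ (fun s => τ s ω) (fun s => ρ s ω)
        (epochStart m (fun s => τ s ω) t) (q t ω))} with hN
  have h5 : μ.real N = 0 := by
    rw [Measure.real, show μ N = 0 from hae, ENNReal.toReal_zero]
  set R := {ω | M.regret T πs (fun t => π t ω) ≤
      33 * (L * Fintype.card S * √(T * Fintype.card A * logTerm S A T δ))}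
  -- Subadditivity on a cover of the whole space bounds the regret event from below without any
  -- measurability of the sets involved.
  have hcover : Set.univ ⊆ R ∪ (B1 ∪ (B2 ∪ (B3 ∪ (B4 ∪ N)))) := by
    intro ω _
    by_contra hω
    simp only [Set.mem_union, not_or] at hω
    obtain ⟨hR, n1, n2, n3, n4, n5⟩ := hω
    have n5 := not_not.1 n5
    obtain ⟨⟨hval, hind⟩, hq⟩ := n5
    refine hR (regret_le_of_good hm hL hT hδ hδ1 hπs hval hind hq (fun t ht => ?_)
      (fun t ht x a => ?_) ?_)
    · by_contra h
      exact n1 ⟨hval, t, ht, h⟩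
    · rw [abs_le']
      constructor
      · by_contra h
        exact n2 ⟨hval, t, ht, x, a, by linarith⟩
      · by_contra h
        exact n3 ⟨hval, t, ht, x, a, by linarith⟩
    · exact (not_le.1 n4).le
  have h6 := measureReal_mono (μ := μ) hcover
  rw [probReal_univ] at h6
  have u1 := measureReal_union_le (μ := μ) R (B1 ∪ (B2 ∪ (B3 ∪ (B4 ∪ N))))
  have u2 := measureReal_union_le (μ := μ) B1 (B2 ∪ (B3 ∪ (B4 ∪ N)))
  have u3 := measureReal_union_le (μ := μ) B2 (B3 ∪ (B4 ∪ N))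
  have u4 := measureReal_union_le (μ := μ) B3 (B4 ∪ N)
  have u5 := measureReal_union_le (μ := μ) B4 N
  linarith

end Regret

end UCRLLP

end

theorem theorem1 :
    ∃ C : ℝ, 0 < C ∧
      ∀ (S : Type u) (A : Type v) [Fintype S] [DecidableEq S] [Fintype A] [DecidableEq A]
        [Nonempty A] (L T : ℕ) (δ : ℝ), 0 < δ → δ < 1 →
      ∀ (M : UCRLLP.LayeredMDP S A L) (m : ℕ), m ≤ 1 →
      ∀ (Ω : Type w) [mΩ : MeasurableSpace Ω] (μ : Measure Ω) [IsProbabilityMeasure μ]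
        (ℱ : Filtration ℕ mΩ)
        (τ : ℕ → Ω → UCRLLP.Traj S A L) (ρ : ℕ → Ω → Fin L → ℝ)
        (q : ℕ → Ω → S → A → S → ℝ) (π : ℕ → Ω → S → A → ℝ),
        UCRLLP.IsRun M T δ m μ ℱ τ ρ q π →
      ∀ πs : S → A → ℝ, M.IsOptimal πs →
        1 - 5 * δ ≤ μ.real {ω | M.regret T πs (fun t => π t ω) ≤
          C * (L * Fintype.card S *
            √(T * Fintype.card A *
              Real.log (T * Fintype.card S * Fintype.card A / δ)))} := by
  refine ⟨33, by norm_num, ?_⟩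
  intro S A _ _ _ _ _ L T δ hδ hδ1 M m hm Ω mΩ μ _ ℱ τ ρ q π hrun πs hπs
  -- For `T = 0` or `L = 0` both the regret and the bound are zero.
  rcases Nat.eq_zero_or_pos T with rfl | hT
  · simp [UCRLLP.LayeredMDP.regret]
    linarith
  rcases Nat.eq_zero_or_pos L with rfl | hL
  · simp [UCRLLP.LayeredMDP.regret, UCRLLP.LayeredMDP.V]
    linarith
  have := hrun.regret_bound hm hL hT hδ hδ1 hπs.1
  rw [UCRLLP.logTerm] at this
  linarith
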